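/- Consider an explicit Runge--Kutta scheme with $s$ stages, weights $b_i\in\mathbb C$ and coefficients $a_{ij}\in\mathbb C$ ($j<i$). For a linear system $u'=\mathbf L u$, $\mathbf L\in\mathbb C^{n\times n}$, one step with time step $\tau>0$ is $$u^1=u^0+\tau\sum_{i=1}^s b_iK_i,\qquad K_i=\mathbf L\Big(u^0+\tau\sum_{j=1}^{i-1}a_{ij}K_j\Big),\quad i=1,\dots,s.$$ Its stability function is the polynomial $R(z)=\sum_{j=0}^{s} c_j z^j/j!$ with $u^1=R(\tau\mathbf L)u^0$; put $c_j=0$ for $j>s$. The scheme has order $p$ (for linear systems) if $u(\tau)-u^1=O(\tau^{p+1})$ as $\tau\to0^+$ for every $\mathbf L$ and every exact solution $u$ of $u'=\mathbf L u$ with $u(0)=u^0$. Let $\mathbf L_H=(\mathbf L+\mathbf L^*)/2$ and $\mathbf L_S=(\mathbf L-\mathbf L^*)/2$. Let $\mathcal L_{AS}$ be the set of all complex square matrices $\mathbf L$, of any dimension, that are asymptotically stable (all eigenvalues have negative real part) and semi-dissipative ($\mathbf L_H\le 0$). The hypocoercivity index $m_{HC}(\mathbf L)$ is the smallest $m\in\mathbb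 N_0$ such that $\sum_{j=0}^m\mathbf L_S^j\mathbf L_H(\mathbf L_S^*)^j<0$ (and $\infty$ if there is none). Put $\mathcal L_{AS}^m=\{\mathbf L\in\mathcal L_{AS}: m_{HC}(\mathbf L)\le m\}$. The scheme is called strongly stable with respect to a set $\mathcal L_0\subset\mathcal L_{AS}$ if for every $\mathbf L\in\mathcal L_0$ there is $\tau_0>0$ such that $\|u^1\|\le\|u^0\|$ in the Euclidean norm for all $u^0$ and all $\tau\in(0,\tau_0]$. Suppose that the scheme has order $p\ge1$. Then: (a) The scheme is strongly stable with respect to $\mathcal L_{AS}^m$ for every $m\in\mathbb N_0$ with $2m+1\le p$. (b) Suppose in addition that $c_{p+1}$ is real and satisfies $$(-1)^{(p+1)/2}(1-c_{p+1})<0\ \text{ if } p \text{ is odd},\qquad 1+(-1)^{p/2}(c_{p+1}-1)\tbinom{p}{p/2}<0\ \text{ if } p\text{ is even}.$$ Then the scheme is not strongly stable with respect to $\mathcal L_{AS}$. (c) Under the hypotheses of (b), the scheme is not strongly stable with respect to $\{\mathbf L\}$ for any single $\mathbf L\in\mathcal L_{AS}$ with $2m_{HC}(\mathbf L)+1>p$.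 In particular, for every $m\in\mathbb N_0$ with $2m+1\le p$ it is strongly stable with respect to $\mathcal L_{AS}^m$ but not with respect to $\mathcal L_{AS}\setminus\mathcal L_{AS}^m$. -/

import Mathlib

open Matrix Filter Topology Asymptotics
open scoped ComplexOrder

noncomputable section

/-- An explicit Runge--Kutta scheme with `s` stages, weights `b i` and coefficients `a i j`.
Only the entries `a i j` with `j < i` are ever used. -/
structure ExplicitRK where
  s : ℕ
  a : Fin s → Fin s → ℂ
  b : Fin s → ℂ

namespace ExplicitRK

/-- The stages `K i = F (u + τ ∑_{j < i} a i j • K j)` of the scheme applied to `u' = F u`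
with time step `τ`, started at `u`. -/
def stage (M : ExplicitRK) {V : Type*} [AddCommGroup V] [Module ℂ V]
    (F : V →ₗ[ℂ] V) (τ : ℂ) (u : V) (i : Fin M.s) : V :=
  F (u + τ • ∑ j : Fin i.val,
    M.a i ⟨j.val, j.isLt.trans i.isLt⟩ • stage M F τ u ⟨j.val, j.isLt.trans i.isLt⟩)
termination_by i.val
decreasing_by exact j.isLt

/-- One step `u + τ ∑ i, b i • K i` of the scheme. -/
def step (M : ExplicitRK) {V : Type*} [AddCommGroup V] [Module ℂ V]
    (F : V →ₗ[ℂ] V) (τ : ℂ) (u : V) : V :=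
  u + τ • ∑ i : Fin M.s, M.b i • M.stage F τ u i

/-- One step of the scheme for the linear system `u' = L u` in `ℂⁿ`, with time step `τ`. -/
def matStep (M : ExplicitRK) {n : ℕ} (L : Matrix (Fin n) (Fin n) ℂ) (τ : ℝ)
    (u : EuclideanSpace ℂ (Fin n)) : EuclideanSpace ℂ (Fin n) :=
  M.step (Matrix.toEuclideanLin L) (τ : ℂ) u

/-- The stability function `R`: the result of one step for the scalar test equation `u' = z u`
with `u⁰ = 1` and unit time step, as a polynomial in `z`. -/
def stabilityFunction (M : ExplicitRK) : Polynomial ℂ :=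
  M.step (LinearMap.mulLeft ℂ (Polynomial.X : Polynomial ℂ)) 1 1

/-- The normalized coefficients `c j` in `R(z) = ∑ j, c j * z ^ j / j!`. -/
def stabilityCoeff (M : ExplicitRK) (j : ℕ) : ℂ :=
  (j.factorial : ℂ) * M.stabilityFunction.coeff j

/-- The scheme has order (at least) `p` for linear systems with constant coefficients: its local
error along every exact solution of every system `u' = L u` is `O(τ ^ (p + 1))`. -/
def HasOrder (M : ExplicitRK) (p : ℕ) : Prop :=
  ∀ (n : ℕ) (L : Matrix (Fin n) (Fin n) ℂ) (u : ℝ → EuclideanSpace ℂ (Fin n)),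
    (∀ t, HasDerivAt u (Matrix.toEuclideanLin L (u t)) t) →
      (fun τ : ℝ => u τ - M.matStep L τ (u 0)) =O[𝓝[>] 0] (fun τ : ℝ => τ ^ (p + 1))

/-- Strong stability with respect to a set `S` of (semi-dissipative) matrices of arbitrary
dimensions: for each `L ∈ S`, one step does not increase the Euclidean norm of any initial datum,
for all sufficiently small time steps (depending on `L` only). -/
def StronglyStableOn (M : ExplicitRK) (S : Set (Σ n : ℕ, Matrix (Fin n) (Fin n) ℂ)) : Prop :=
  ∀ L ∈ S, ∃ τ₀ : ℝ, 0 < τ₀ ∧ ∀ τ : ℝ, 0 < τ → τ ≤ τ₀ →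
    ∀ u : EuclideanSpace ℂ (Fin L.1), ‖M.matStep L.2 τ u‖ ≤ ‖u‖

end ExplicitRK

/-- The Hermitian part of a matrix. -/
def hermPart {n : ℕ} (L : Matrix (Fin n) (Fin n) ℂ) : Matrix (Fin n) (Fin n) ℂ :=
  (1 / 2 : ℂ) • (L + Lᴴ)

/-- The skew-Hermitian part of a matrix. -/
def skewPart {n : ℕ} (L : Matrix (Fin n) (Fin n) ℂ) : Matrix (Fin n) (Fin n) ℂ :=
  (1 / 2 : ℂ) • (L - Lᴴ)

/-- Semi-dissipativity: the Hermitian part is negative semi-definite. -/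
def IsSemiDissipative {n : ℕ} (L : Matrix (Fin n) (Fin n) ℂ) : Prop :=
  (-hermPart L).PosSemidef

/-- Asymptotic stability: all eigenvalues have negative real part. -/
def IsAsymptoticallyStable {n : ℕ} (L : Matrix (Fin n) (Fin n) ℂ) : Prop :=
  ∀ μ : ℂ, Module.End.HasEigenvalue (Matrix.toLin' L) μ → μ.re < 0

/-- The matrix `T_m = ∑_{j=0}^m L_S^j L_H (L_S^*)^j`. -/
def hcMatrix {n : ℕ} (L : Matrix (Fin n) (Fin n) ℂ) (m : ℕ) : Matrix (Fin n) (Fin n) ℂ :=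
  ∑ j ∈ Finset.range (m + 1), skewPart L ^ j * hermPart L * (skewPart L)ᴴ ^ j

/-- The hypocoercivity index: the smallest `m` such that `T_m` is negative definite
(and `⊤` if there is none). -/
def hcIndex {n : ℕ} (L : Matrix (Fin n) (Fin n) ℂ) : ℕ∞ :=
  sInf {k : ℕ∞ | ∃ m : ℕ, k = (m : ℕ∞) ∧ (-hcMatrix L m).PosDef}

/-- The set of asymptotically stable, semi-dissipative matrices of all dimensions. -/
def LAS : Set (Σ n : ℕ, Matrix (Fin n) (Fin n) ℂ) :=
  {L | IsAsymptoticallyStable L.2 ∧ IsSemiDissipative L.2}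

/-- The members of `LAS` with hypocoercivity index at most `m`. -/
def LASle (m : ℕ) : Set (Σ n : ℕ, Matrix (Fin n) (Fin n) ℂ) :=
  {L | L ∈ LAS ∧ hcIndex L.2 ≤ (m : ℕ∞)}

/-- The sign condition on `c = c_{p+1}`. All divisions by two are exact. -/
def SignCondition (p : ℕ) (c : ℝ) : Prop :=
  (Odd p ∧ (-1 : ℝ) ^ ((p + 1) / 2) * (1 - c) < 0) ∨
  (Even p ∧ 1 + (-1 : ℝ) ^ (p / 2) * (c - 1) * (p.choose (p / 2) : ℝ) < 0)

end

/-! Write `-L_H = B*B`. One step is `R(τL)`, and order `p` means that `R` agrees with `exp` through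
degree `p`. A semi-dissipative `L` satisfies `⟨Lx,y⟩ + ⟨x,Ly⟩ = -2⟨Bx,By⟩`, and `T_m < 0` holds
exactly when `BL^j u = 0` for all `j ≤ m` forces `u = 0` (`posDef_neg_hcMatrix_iff`).

Stability (`exists_norm_aeval_le_norm`): since `R' = R + O(z^p)`, the curve `w(t) = R(tL)u` has
`d/dt ‖w‖² = -2‖Bw‖² + O(t^p)‖u‖²`. Up to a factor and a higher-order error, `Bw` is a polynomial of
degree `m` in `t` with coefficients `BL^j u / j!`. The integral of its squared norm over `[0,τ]` is
at least of order `τ^(2m+1)‖u‖²`, which beats the error `O(τ^(2m+2))‖u‖²` when `2m+1 ≤ p`.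

Instability (`eventually_norm_lt_of_pade_error`): let `k = (p+1)/2`, rounded down, and let
`D(-z)/D(z)` be the diagonal Padé approximant of `exp` of degree `k`. If `BL^j v = 0` for `j < k`,
then `L` acts as a skew operator on the first Krylov vectors of `v`, so `‖D(-τL)v‖ = ‖D(τL)v‖`. From
the datum `D(τL)v` the scheme reaches `D(-τL)v + κτ^(p+1)L^(p+1)v + ...`, hence the norm grows if `κ
Re⟨v, L^(p+1)v⟩ > 0`. The sign condition on `c_{p+1}` is precisely what yields this sign. A damped
chain supplies stable matrices of large index. -/

/-! ### Stability function and order conditions. -/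

-- Evaluation at `τF` carries the stage recursion in `ℂ[X]` to the one in `V`. The factor `τ` on the
-- right appears because multiplication by `X` becomes `τF`, not `F`.
open Polynomial in
theorem ExplicitRK.aeval_stage (M : ExplicitRK) {V : Type*} [AddCommGroup V] [Module ℂ V]
    (F : Module.End ℂ V) (τ : ℂ) (u : V) (i : Fin M.s) :
    aeval (τ • F) (M.stage (LinearMap.mulLeft ℂ (X : ℂ[X])) 1 1 i) u = τ • M.stage F τ u i := by
  induction hi : i.val using Nat.strong_induction_on generalizing i with
  | _ k ih =>
    subst hi
    rw [ExplicitRK.stage, ExplicitRK.stage]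
    simp only [one_smul, LinearMap.mulLeft_apply, map_mul, aeval_X, map_add, map_one, map_sum,
      map_smul, Module.End.mul_apply, LinearMap.add_apply, Module.End.one_apply,
      LinearMap.sum_apply, LinearMap.smul_apply]
    rw [smul_add, Finset.smul_sum, Finset.smul_sum]
    congr 1
    refine Finset.sum_congr rfl fun j _ => ?_
    rw [ih j.val j.isLt ⟨j.val, j.isLt.trans i.isLt⟩ rfl]
    simp only [map_smul, smul_comm (M.a i _) τ]

open Polynomial in
theorem ExplicitRK.step_eq_aeval (M : ExplicitRK) {V : Type*} [AddCommGroup V] [Module ℂ V]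
    (F : Module.End ℂ V) (τ : ℂ) (u : V) :
    M.step F τ u = aeval (τ • F) M.stabilityFunction u := by
  simp only [stabilityFunction, step, one_smul, map_add, map_one, map_sum, map_smul,
    LinearMap.add_apply, Module.End.one_apply, LinearMap.sum_apply, LinearMap.smul_apply,
    aeval_stage, Finset.smul_sum]
  simp only [smul_comm τ]

theorem ExplicitRK.matStep_eq_aeval (M : ExplicitRK) {n : ℕ} (L : Matrix (Fin n) (Fin n) ℂ) (τ : ℝ)
    (u : EuclideanSpace ℂ (Fin n)) :
    M.matStep L τ u =
      Polynomial.aeval ((τ : ℂ) • (Matrix.toEuclideanLin L : Module.End ℂ _))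
        M.stabilityFunction u :=
  M.step_eq_aeval _ _ _

/-- A polynomial that is `O(τ ^ N)` as `τ → 0+` is divisible by `X ^ N`. -/
theorem Polynomial.X_pow_dvd_of_isBigO (Q : Polynomial ℂ) (N : ℕ)
    (h : (fun τ : ℝ => Q.eval (τ : ℂ)) =O[𝓝[>] 0] (fun τ : ℝ => τ ^ N)) :
    Polynomial.X ^ N ∣ Q := by
  induction N with
  | zero => simp
  | succ N ih =>
    have hle : (fun τ : ℝ => τ ^ (N + 1)) =O[𝓝[>] 0] (fun τ : ℝ => τ ^ N) := by
      refine (IsBigO.of_bound 1 ?_).trans (isBigO_refl _ _)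
      filter_upwards [Ioc_mem_nhdsGT (zero_lt_one' ℝ)] with τ hτ
      rw [one_mul, norm_pow, norm_pow, pow_succ]
      refine mul_le_of_le_one_right (by positivity) ?_
      rw [Real.norm_of_nonneg hτ.1.le]
      exact hτ.2
    obtain ⟨Q₁, rfl⟩ := ih (h.trans hle)
    have h0 : Q₁.eval 0 = 0 := by
      have h1 : (fun τ : ℝ => Q₁.eval (τ : ℂ)) =O[𝓝[>] 0] (fun τ : ℝ => τ) := by
        obtain ⟨C, hC⟩ := h.bound
        refine IsBigO.of_bound C ?_
        filter_upwards [hC, self_mem_nhdsWithin] with τ hτ hpos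
        have hpos' : (0 : ℝ) < τ := hpos
        have hp : 0 < τ ^ N := by positivity
        simp only [Polynomial.eval_mul, Polynomial.eval_pow, Polynomial.eval_X, norm_mul, norm_pow,
          Complex.norm_real, Real.norm_of_nonneg hpos'.le] at hτ ⊢
        refine le_of_mul_le_mul_left (hτ.trans (le_of_eq ?_)) hp
        ring
      have h2 : Tendsto (fun τ : ℝ => Q₁.eval (τ : ℂ)) (𝓝[>] 0) (𝓝 0) :=
        h1.trans_tendsto (tendsto_id.mono_left nhdsWithin_le_nhds)
      have h3 : Tendsto (fun τ : ℝ => Q₁.eval (τ : ℂ)) (𝓝[>] 0) (𝓝 (Q₁.eval ((0 : ℝ) : ℂ))) :=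
        ((Q₁.continuous.comp Complex.continuous_ofReal).tendsto 0).mono_left nhdsWithin_le_nhds
      simpa using tendsto_nhds_unique h3 h2
    obtain ⟨Q₂, rfl⟩ : Polynomial.X ∣ Q₁ :=
      Polynomial.X_dvd_iff.2 (by rwa [Polynomial.coeff_zero_eq_eval_zero])
    exact ⟨Q₂, by ring⟩

/-- The scalar equation `u' = u` already determines these coefficients: both `R` and the Taylor
polynomial are within `O(τ^(p+1))` of `exp`. -/
theorem ExplicitRK.HasOrder.coeff_stabilityFunction {M : ExplicitRK} {p : ℕ} (hM : M.HasOrder p)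
    {j : ℕ} (hj : j ≤ p) : M.stabilityFunction.coeff j = (j.factorial : ℂ)⁻¹ := by
  set e : EuclideanSpace ℂ (Fin 1) := EuclideanSpace.single 0 1 with he
  have hL : (Matrix.toEuclideanLin (1 : Matrix (Fin 1) (Fin 1) ℂ) : Module.End ℂ _) = 1 := by
    ext x; simp [Matrix.toEuclideanLin]
  have hu : ∀ t : ℝ, HasDerivAt (fun t : ℝ => Complex.exp t • e)
      (Matrix.toEuclideanLin (1 : Matrix (Fin 1) (Fin 1) ℂ) (Complex.exp t • e)) t := by
    intro t
    have h1 : HasDerivAt (fun t : ℝ => Complex.exp t) (Complex.exp t) t :=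
      (Complex.hasDerivAt_exp t).comp_ofReal
    have h2 := h1.smul_const e
    have h3 : Matrix.toEuclideanLin (1 : Matrix (Fin 1) (Fin 1) ℂ) (Complex.exp t • e)
        = Complex.exp t • e := by
      simp [Matrix.toEuclideanLin]
    rwa [h3]
  have hO := hM 1 1 _ hu
  set T : Polynomial ℂ :=
    ∑ i ∈ Finset.range (p + 1), Polynomial.C ((i.factorial : ℂ)⁻¹) * Polynomial.X ^ i with hT
  have hR : ∀ τ : ℝ, M.matStep 1 τ e = M.stabilityFunction.eval (τ : ℂ) • e := by
    intro τ
    rw [M.matStep_eq_aeval, hL]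
    have : (τ : ℂ) • (1 : Module.End ℂ (EuclideanSpace ℂ (Fin 1)))
      = algebraMap ℂ _ (τ : ℂ) := by rw [Algebra.algebraMap_eq_smul_one]
    rw [this, Polynomial.aeval_algebraMap_apply]
    simp [Module.algebraMap_end_apply]
  have h1 : (fun τ : ℝ => Complex.exp τ - M.stabilityFunction.eval (τ : ℂ))
      =O[𝓝[>] 0] (fun τ : ℝ => τ ^ (p + 1)) := by
    refine IsBigO.trans (IsBigO.of_bound 1 (Eventually.of_forall fun τ => ?_)) hO
    simp only [Complex.ofReal_zero, Complex.exp_zero, one_smul, hR]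
    rw [← sub_smul, norm_smul, he]
    simp
  have h2 : (fun τ : ℝ => Complex.exp τ - T.eval (τ : ℂ))
      =O[𝓝[>] 0] (fun τ : ℝ => τ ^ (p + 1)) := by
    obtain ⟨C, hC⟩ : ∃ C : ℝ, ∀ x : ℂ, ‖x‖ ≤ 1 →
        ‖Complex.exp x - ∑ m ∈ Finset.range (p + 1), x ^ m / m.factorial‖ ≤ ‖x‖ ^ (p + 1) * C :=
      ⟨_, fun x hx => Complex.exp_bound hx (Nat.succ_pos p)⟩
    refine IsBigO.of_bound C ?_
    filter_upwards [Ioc_mem_nhdsGT (zero_lt_one' ℝ)] with τ hτ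
    have hn : ‖(τ : ℂ)‖ = τ := by rw [Complex.norm_real, Real.norm_of_nonneg hτ.1.le]
    have := hC τ (by rw [hn]; exact hτ.2)
    rw [hn] at this
    rw [norm_pow, Real.norm_of_nonneg hτ.1.le, mul_comm C]
    convert this using 4
    rw [hT, Polynomial.eval_finsetSum]
    refine Finset.sum_congr rfl fun i _ => ?_
    simp [div_eq_inv_mul]
  have h3 := Polynomial.X_pow_dvd_of_isBigO (M.stabilityFunction - T) (p + 1) (by
    refine (h2.sub h1).congr_left fun τ => ?_
    rw [Polynomial.eval_sub]; ring)
  have h4 := Polynomial.X_pow_dvd_iff.1 h3 j (by omega)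
  rw [Polynomial.coeff_sub, sub_eq_zero] at h4
  rw [h4, hT, Polynomial.finsetSum_coeff]
  simp [Polynomial.coeff_X_pow, Nat.lt_succ_of_le hj]

/-! ### Padé denominators and the leading error coefficient. -/

/-- The coefficients of the denominator of the diagonal `(k, k)` Padé approximant of `exp`. -/
noncomputable def padeCoeff (k j : ℕ) : ℝ :=
  (-1) ^ j * (k.choose j : ℝ) * ((2 * k - j).factorial : ℝ) / ((2 * k).factorial : ℝ)

theorem padeCoeff_zero (k : ℕ) : padeCoeff k 0 = 1 := by
  have : ((2 * k).factorial : ℝ) ≠ 0 := by positivity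
  simp [padeCoeff, this]

theorem padeCoeff_of_lt {k j : ℕ} (h : k < j) : padeCoeff k j = 0 := by
  simp [padeCoeff, Nat.choose_eq_zero_of_lt h]

/-- Compare coefficients of `X^(2k-n)` after expanding `X^k = (-1 + (1+X))^k` in `X^k (1+X)^k`. -/
theorem sum_neg_one_pow_choose_mul_choose (k n : ℕ) (hn : n ≤ 2 * k) :
    ∑ j ∈ Finset.range (k + 1), (-1 : ℝ) ^ j * (k.choose j : ℝ) *
      ((2 * k - j).choose (2 * k - n) : ℝ) = (k.choose n : ℝ) := by
  have key : ∑ j ∈ Finset.range (k + 1), Polynomial.C ((-1 : ℝ) ^ j * (k.choose j : ℝ)) *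
      (1 + Polynomial.X) ^ (2 * k - j) = Polynomial.X ^ k * (1 + Polynomial.X) ^ k := by
    have h := add_pow (-1 : Polynomial ℝ) (1 + Polynomial.X) k
    rw [neg_add_cancel_left] at h
    rw [h, Finset.sum_mul]
    refine Finset.sum_congr rfl fun j hj => ?_
    have hj' : 2 * k - j = (k - j) + k := by
      have := Finset.mem_range.1 hj; omega
    rw [hj', pow_add]
    simp only [map_mul, map_pow, map_neg, map_one, map_natCast]
    ring
  have h := congrArg (fun P => Polynomial.coeff P (2 * k - n)) key
  simp only [Polynomial.finsetSum_coeff, Polynomial.coeff_C_mul, Polynomial.coeff_one_add_X_pow,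
    Polynomial.coeff_X_pow_mul'] at h
  rw [h]
  split_ifs with hk
  · rw [show 2 * k - n - k = k - n by omega, Nat.choose_symm (by omega)]
  · rw [Nat.choose_eq_zero_of_lt (by omega), Nat.cast_zero]

/-- The Padé property: `e^z D(z)` and `D(-z)` have the same coefficients through degree `2k`. -/
theorem sum_padeCoeff_mul_inv_factorial {k n : ℕ} (hn : n ≤ 2 * k) :
    ∑ j ∈ Finset.range (n + 1), padeCoeff k j * ((n - j).factorial : ℝ)⁻¹
      = (-1) ^ n * padeCoeff k n := by
  have h1 : ∀ j ∈ Finset.range (n + 1), padeCoeff k j * ((n - j).factorial : ℝ)⁻¹ =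
      ((2 * k - n).factorial : ℝ) / ((2 * k).factorial : ℝ) * ((-1 : ℝ) ^ j * (k.choose j : ℝ) *
      ((2 * k - j).choose (2 * k - n) : ℝ)) := by
    intro j hj
    have hj' : j ≤ n := by have := Finset.mem_range.1 hj; omega
    have h := Nat.choose_mul_factorial_mul_factorial (show 2 * k - n ≤ 2 * k - j by omega)
    rw [show 2 * k - j - (2 * k - n) = n - j by omega] at h
    have h' : ((2 * k - j).factorial : ℝ) = ((2 * k - j).choose (2 * k - n) : ℝ) *
      ((2 * k - n).factorial : ℝ) * ((n - j).factorial : ℝ) := by exact_mod_cast h.symm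
    have h0 : ((n - j).factorial : ℝ) ≠ 0 := by positivity
    have h0' : ((2 * k).factorial : ℝ) ≠ 0 := by positivity
    rw [padeCoeff, h']
    field_simp
  rw [Finset.sum_congr rfl h1, ← Finset.mul_sum]
  -- Both sums extend to `j ≤ 2k`: one binomial factor vanishes for `j > n`, the other for `j > k`.
  have h2 : ∑ j ∈ Finset.range (n + 1), (-1 : ℝ) ^ j * (k.choose j : ℝ) *
      ((2 * k - j).choose (2 * k - n) : ℝ) = ∑ j ∈ Finset.range (k + 1), (-1 : ℝ) ^ j *
      (k.choose j : ℝ) * ((2 * k - j).choose (2 * k - n) : ℝ) := by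
    have ha : ∑ j ∈ Finset.range (n + 1), (-1 : ℝ) ^ j * (k.choose j : ℝ) *
      ((2 * k - j).choose (2 * k - n) : ℝ) = ∑ j ∈ Finset.range (2 * k + 1), (-1 : ℝ) ^ j *
      (k.choose j : ℝ) * ((2 * k - j).choose (2 * k - n) : ℝ) := by
      refine Finset.sum_subset (Finset.range_mono (by omega)) fun j hj hj' => ?_
      simp only [Finset.mem_range] at hj hj'
      rw [Nat.choose_eq_zero_of_lt (show 2 * k - j < 2 * k - n by omega)]
      simp
    rw [ha]
    refine (Finset.sum_subset (Finset.range_mono (by omega)) fun j hj hj' => ?_).symm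
    simp only [Finset.mem_range] at hj hj'
    rw [Nat.choose_eq_zero_of_lt (show k < j by omega)]
    simp
  have hs : ((-1 : ℝ) ^ n) * (-1) ^ n = 1 := by rw [← mul_pow]; simp
  rw [h2, sum_neg_one_pow_choose_mul_choose k n hn, padeCoeff]
  linear_combination (-(k.choose n : ℝ) * ((2 * k - n).factorial : ℝ) /
    ((2 * k).factorial : ℝ)) * hs

/-- This is the beta integral of `t^x (1-t)^k` over `[0,1]`, obtained here from Pascal's rule by
induction on `k`. -/
theorem sum_neg_one_pow_choose_div (k x : ℕ) :
    ∑ j ∈ Finset.range (k + 1), (-1 : ℝ) ^ j * (k.choose j : ℝ) / ((x : ℝ) + 1 + j)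
      = (k.factorial : ℝ) * (x.factorial : ℝ) / ((x + k + 1).factorial : ℝ) := by
  induction k generalizing x with
  | zero =>
    have : (x.factorial : ℝ) ≠ 0 := by positivity
    have : (x : ℝ) + 1 ≠ 0 := by positivity
    simp [Nat.factorial_succ]
    field_simp
  | succ k ih =>
    have hsplit : ∑ j ∈ Finset.range (k + 1 + 1), (-1 : ℝ) ^ j * ((k + 1).choose j : ℝ) /
        ((x : ℝ) + 1 + j) =
        ∑ j ∈ Finset.range (k + 1), (-1 : ℝ) ^ j * (k.choose j : ℝ) / ((x : ℝ) + 1 + j) -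
        ∑ j ∈ Finset.range (k + 1), (-1 : ℝ) ^ j * (k.choose j : ℝ) /
          (((x + 1 : ℕ) : ℝ) + 1 + j) := by
      have e1 : ∑ j ∈ Finset.range (k + 1), (-1 : ℝ) ^ j * (k.choose j : ℝ) / ((x : ℝ) + 1 + j) =
          ∑ j ∈ Finset.range (k + 1 + 1), (-1 : ℝ) ^ j * (k.choose j : ℝ) / ((x : ℝ) + 1 + j) := by
        rw [Finset.sum_range_succ _ (k + 1)]
        simp
      rw [e1, Finset.sum_range_succ', Finset.sum_range_succ' _ (k + 1), add_sub_right_comm,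
        ← Finset.sum_sub_distrib]
      congr 1
      · refine Finset.sum_congr rfl fun j _ => ?_
        rw [Nat.choose_succ_succ]
        push_cast
        ring
      · simp
    rw [hsplit, ih, ih]
    have h1 : (x + (k + 1) + 1).factorial = (x + k + 2) * (x + k + 1).factorial := by
      rw [show x + (k + 1) + 1 = (x + k + 1) + 1 by ring, Nat.factorial_succ]
    have h2 : x + 1 + k + 1 = x + (k + 1) + 1 := by ring
    have h0 : ((x + k + 1).factorial : ℝ) ≠ 0 := by positivity
    have h0' : (x : ℝ) + k + 2 ≠ 0 := by positivity
    rw [h2, h1, Nat.factorial_succ k, Nat.factorial_succ x]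
    push_cast
    field_simp
    ring

/-- The first defect of the Padé approximant, as `D(-z)` has no term of degree `2k+1`. It is the
source of the central binomial coefficient in the sign condition for even `p`. -/
theorem sum_padeCoeff_mul_inv_factorial_succ (k : ℕ) :
    ∑ j ∈ Finset.range (2 * k + 1 + 1), padeCoeff k j * ((2 * k + 1 - j).factorial : ℝ)⁻¹
      = (-1) ^ k * ((2 * k).choose k : ℝ)⁻¹ * ((2 * k + 1).factorial : ℝ)⁻¹ := by
  have h1 : ∑ j ∈ Finset.range (2 * k + 1 + 1),
      padeCoeff k j * ((2 * k + 1 - j).factorial : ℝ)⁻¹ =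
      ∑ j ∈ Finset.range (k + 1), padeCoeff k j * ((2 * k + 1 - j).factorial : ℝ)⁻¹ := by
    refine (Finset.sum_subset (Finset.range_mono (by omega)) fun j hj hj' => ?_).symm
    simp only [Finset.mem_range] at hj hj'
    rw [padeCoeff_of_lt (by omega), zero_mul]
  -- The index `k + 1 - 1 - j` is the form produced by `Finset.sum_range_reflect`; reversing the sum
  -- gives the denominators `k + 1 + j`.
  have h2 : ∀ j ∈ Finset.range (k + 1),
      padeCoeff k (k + 1 - 1 - j) * ((2 * k + 1 - (k + 1 - 1 - j)).factorial : ℝ)⁻¹ =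
      (-1) ^ k * ((2 * k).factorial : ℝ)⁻¹ *
        ((-1 : ℝ) ^ j * (k.choose j : ℝ) / ((k : ℝ) + 1 + j)) := by
    intro j hj
    have hj' : j ≤ k := by have := Finset.mem_range.1 hj; omega
    have hs : (-1 : ℝ) ^ (k - j) = (-1) ^ k * (-1) ^ j := by
      obtain ⟨i, rfl⟩ := Nat.exists_eq_add_of_le hj'
      rw [Nat.add_sub_cancel_left, mul_comm, ← pow_add, ← add_assoc, pow_add, ← two_mul, pow_mul]
      simp
    rw [Nat.add_sub_cancel, padeCoeff, Nat.choose_symm hj', hs,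
      show 2 * k + 1 - (k - j) = (k + j) + 1 by omega, show 2 * k - (k - j) = k + j by omega,
      Nat.factorial_succ]
    have h0 : ((k + j).factorial : ℝ) ≠ 0 := by positivity
    have h0' : (k : ℝ) + 1 + j ≠ 0 := by positivity
    have h0'' : (k : ℝ) + j + 1 ≠ 0 := by positivity
    push_cast
    field_simp
    ring
  rw [h1, ← Finset.sum_range_reflect, Finset.sum_congr rfl h2, ← Finset.mul_sum,
    sum_neg_one_pow_choose_div]
  have h := Nat.choose_mul_factorial_mul_factorial (show k ≤ 2 * k by omega)
  rw [show 2 * k - k = k by omega] at h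
  have h' : ((2 * k).factorial : ℝ) = ((2 * k).choose k : ℝ) *
      (k.factorial : ℝ) * (k.factorial : ℝ) := by exact_mod_cast h.symm
  rw [h', show k + k + 1 = 2 * k + 1 by ring]
  have h0 : (k.factorial : ℝ) ≠ 0 := by positivity
  have h1 : ((2 * k).choose k : ℝ) ≠ 0 := by
    have := Nat.choose_pos (show k ≤ 2 * k by omega)
    positivity
  field_simp

/-- `D(ε z)` for the denominator `D` of the diagonal Padé approximant of `exp`. -/
noncomputable def padePoly (k : ℕ) (ε : ℝ) : Polynomial ℂ :=
  ∑ j ∈ Finset.range (k + 1), Polynomial.C ((ε ^ j * padeCoeff k j : ℝ) : ℂ) * Polynomial.X ^ j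

theorem coeff_padePoly (k : ℕ) (ε : ℝ) (n : ℕ) :
    (padePoly k ε).coeff n = ((ε ^ n * padeCoeff k n : ℝ) : ℂ) := by
  rw [padePoly, Polynomial.finsetSum_coeff]
  simp only [Polynomial.coeff_C_mul_X_pow]
  rw [Finset.sum_ite_eq]
  split_ifs with h
  · rfl
  · rw [padeCoeff_of_lt (by simpa using h)]; simp

/-- The leading error coefficient of `R(z) D(z) - D(-z)`. -/
theorem exists_pade_error {R : Polynomial ℂ} {p : ℕ} {c : ℝ}
    (hR : ∀ j ≤ p, R.coeff j = (j.factorial : ℂ)⁻¹)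
    (hc : ((p + 1).factorial : ℂ) * R.coeff (p + 1) = c) (hs : SignCondition p c) :
    ∃ (κ : ℝ) (Q : Polynomial ℂ),
      R * padePoly ((p + 1) / 2) 1 = padePoly ((p + 1) / 2) (-1) +
        Polynomial.X ^ (p + 1) * (Polynomial.C (κ : ℂ) + Polynomial.X * Q) ∧
      (Odd p → 0 < (-1) ^ ((p + 1) / 2) * κ) ∧ (Even p → (-1) ^ ((p + 1) / 2) * κ < 0) := by
  set k := (p + 1) / 2 with hk
  have hf : ((p + 1).factorial : ℂ) ≠ 0 := by exact_mod_cast (Nat.factorial_pos _).ne'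
  have hc' : R.coeff (p + 1) = ((p + 1).factorial : ℂ)⁻¹ +
      (((c - 1) / ((p + 1).factorial : ℝ) : ℝ) : ℂ) := by
    push_cast
    rw [← hc]
    field_simp
    ring
  have hlow : ∀ n ≤ p, (R * padePoly k 1).coeff n = (padePoly k (-1)).coeff n := by
    intro n hn
    rw [mul_comm, Polynomial.coeff_mul, Finset.Nat.sum_antidiagonal_eq_sum_range_succ_mk,
      coeff_padePoly, ← sum_padeCoeff_mul_inv_factorial (by omega)]
    push_cast
    refine Finset.sum_congr rfl fun j _ => ?_
    rw [coeff_padePoly, hR _ (by simp; omega)]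
    simp
  have htop : (R * padePoly k 1).coeff (p + 1) =
      ((∑ j ∈ Finset.range (p + 1 + 1), padeCoeff k j * ((p + 1 - j).factorial : ℝ)⁻¹ +
        (c - 1) / ((p + 1).factorial : ℝ) : ℝ) : ℂ) := by
    rw [mul_comm, Polynomial.coeff_mul, Finset.Nat.sum_antidiagonal_eq_sum_range_succ_mk,
      Finset.sum_range_succ', Finset.sum_range_succ' _ (p + 1)]
    push_cast
    simp only [coeff_padePoly, padeCoeff_zero]
    rw [hc']
    push_cast
    simp only [one_pow, one_mul, add_assoc]
    congr 1
    refine Finset.sum_congr rfl fun j _ => ?_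
    rw [hR _ (by omega)]
  set κ : ℝ := ∑ j ∈ Finset.range (p + 1 + 1), padeCoeff k j * ((p + 1 - j).factorial : ℝ)⁻¹ +
        (c - 1) / ((p + 1).factorial : ℝ) - (-1) ^ (p + 1) * padeCoeff k (p + 1) with hκ
  have hdvd : Polynomial.X ^ (p + 2) ∣ R * padePoly k 1 - padePoly k (-1) -
      Polynomial.X ^ (p + 1) * Polynomial.C (κ : ℂ) := by
    rw [Polynomial.X_pow_dvd_iff]
    intro n hn
    rw [Polynomial.coeff_sub, Polynomial.coeff_sub, Polynomial.coeff_X_pow_mul']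
    rcases Nat.lt_or_ge p n with h | h
    · obtain rfl : n = p + 1 := by omega
      rw [htop, coeff_padePoly, if_pos le_rfl, Nat.sub_self, Polynomial.coeff_C_zero, hκ]
      push_cast
      ring
    · rw [hlow n h, if_neg (by omega)]
      simp
  obtain ⟨Q, hQ⟩ := hdvd
  refine ⟨κ, Q, ?_, fun ho => ?_, fun he => ?_⟩
  · linear_combination hQ
  · rcases hs with ⟨_, hs⟩ | ⟨he, _⟩
    · have h2 : p + 1 = 2 * k := by obtain ⟨i, hi⟩ := ho; omega
      -- Here `p + 1 = 2k`, a degree in which Padé is still exact, so only the defect of `R`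
      -- remains.
      have : κ = (c - 1) / ((p + 1).factorial : ℝ) := by
        rw [hκ, sum_padeCoeff_mul_inv_factorial (by omega)]
        ring
      rw [this, mul_div_assoc']
      refine div_pos ?_ (by positivity)
      rw [← hk] at hs
      linarith
    · exact absurd he (Nat.not_even_iff_odd.2 ho)
  · rcases hs with ⟨ho, _⟩ | ⟨_, hs⟩
    · exact absurd he (Nat.not_even_iff_odd.2 ho)
    · have h2 : p = 2 * k := by obtain ⟨i, hi⟩ := he; omega
      have h3 : p / 2 = k := by omega
      rw [h3, h2] at hs
      have hC : (0 : ℝ) < ((2 * k).choose k : ℝ) := by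
        exact_mod_cast Nat.choose_pos (show k ≤ 2 * k by omega)
      -- Here `p + 1 = 2k + 1`, so the defect of Padé itself adds to that of `R`.
      have : κ = ((-1) ^ k * ((2 * k).choose k : ℝ)⁻¹ + (c - 1)) / ((2 * k + 1).factorial : ℝ) := by
        rw [hκ, padeCoeff_of_lt (by omega), h2, sum_padeCoeff_mul_inv_factorial_succ]
        ring
      rw [this, mul_div_assoc']
      refine div_neg_of_neg_of_pos ?_ (by positivity)
      have hsq : ((-1 : ℝ) ^ k) * (-1) ^ k = 1 := by rw [← mul_pow]; simp
      have : (-1) ^ k * ((-1) ^ k * ((2 * k).choose k : ℝ)⁻¹ + (c - 1)) =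
          (1 + (-1) ^ k * (c - 1) * ((2 * k).choose k : ℝ)) / ((2 * k).choose k : ℝ) := by
        field_simp
        linear_combination hsq
      rw [this]
      exact div_neg_of_neg_of_pos hs hC

/-! ### Krylov vectors that escape dissipation, and norm growth. -/

section Krylov

variable {E : Type*} [NormedAddCommGroup E] [InnerProductSpace ℂ E]

theorem aeval_smul_apply (L : Module.End ℂ E) (q : Polynomial ℂ) (z : ℂ) (u : E) :
    Polynomial.aeval (z • L) q u =
      ∑ j ∈ Finset.range (q.natDegree + 1), (q.coeff j * z ^ j) • (L ^ j) u := by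
  rw [Polynomial.aeval_eq_sum_range, LinearMap.sum_apply]
  refine Finset.sum_congr rfl fun j _ => ?_
  rw [smul_pow, LinearMap.smul_apply, LinearMap.smul_apply, smul_smul]

theorem aeval_X_pow_mul_apply (L : Module.End ℂ E) (q : Polynomial ℂ) (z : ℂ) (N : ℕ) (u : E) :
    Polynomial.aeval (z • L) (Polynomial.X ^ N * q) u =
      z ^ N • (L ^ N) (Polynomial.aeval (z • L) q u) := by
  rw [map_mul, map_pow, Polynomial.aeval_X, smul_pow, Module.End.mul_apply, LinearMap.smul_apply]

theorem continuous_aeval_smul_apply (L : Module.End ℂ E) (q : Polynomial ℂ) (u : E) :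
    Continuous fun τ : ℝ => Polynomial.aeval ((τ : ℂ) • L) q u := by
  simp only [aeval_smul_apply]
  fun_prop

theorem aeval_padePoly_apply (L : Module.End ℂ E) (k : ℕ) (ε : ℝ) (τ : ℝ) (u : E) :
    Polynomial.aeval ((τ : ℂ) • L) (padePoly k ε) u =
      ∑ j ∈ Finset.range (k + 1), ((ε ^ j * padeCoeff k j * τ ^ j : ℝ) : ℂ) • (L ^ j) u := by
  rw [padePoly, map_sum, LinearMap.sum_apply]
  refine Finset.sum_congr rfl fun j _ => ?_
  rw [map_mul, map_pow, Polynomial.aeval_X, Polynomial.aeval_C, smul_pow, Module.End.mul_apply,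
    LinearMap.smul_apply, Module.algebraMap_end_apply, smul_smul]
  push_cast
  rfl

variable {L B : Module.End ℂ E}
  (hB : ∀ x y, inner ℂ (L x) y + inner ℂ x (L y) = -2 * inner ℂ (B x) (B y))
include hB

theorem re_inner_apply_self (x : E) : (inner ℂ x (L x)).re = -‖B x‖ ^ 2 := by
  have h := congrArg Complex.re (hB x x)
  rw [Complex.add_re, ← inner_conj_symm (L x) x, Complex.conj_re, inner_self_eq_norm_sq_to_K] at h
  have h2 : (-2 * ((‖B x‖ : ℂ)) ^ 2).re = -2 * ‖B x‖ ^ 2 := by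
    rw [← Complex.ofReal_pow]
    simp [-Complex.ofReal_pow]
  have h3 : (inner ℂ x (L x)).re + (inner ℂ x (L x)).re = -2 * ‖B x‖ ^ 2 := h.trans h2
  linarith

/-- As long as `B` kills the left vector, a factor `L` crosses the inner product at the cost of a
sign. -/
theorem inner_pow_apply_pow_apply {u : E} {k : ℕ} (hu : ∀ j < k, B ((L ^ j) u) = 0) {i : ℕ}
    (hi : i ≤ k) (j : ℕ) :
    inner ℂ ((L ^ i) u) ((L ^ j) u) = (-1) ^ i * inner ℂ u ((L ^ (i + j)) u) := by
  induction i generalizing j with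
  | zero => simp
  | succ i ih =>
    have h := hB ((L ^ i) u) ((L ^ j) u)
    rw [hu i (by omega), inner_zero_left, mul_zero, ← Module.End.mul_apply, ← pow_succ',
      ← Module.End.mul_apply, ← pow_succ', ih (by omega) (j + 1)] at h
    rw [eq_neg_of_add_eq_zero_left h, pow_succ, show i + (j + 1) = i + 1 + j by ring]
    ring

/-- In the Gram expansion, the sign `(-1)^(i+j)` turns `⟨L^i u, L^j u⟩` into `⟨L^j u, L^i u⟩`; the
coefficients are real, so exchanging the two sums matches the two sides. -/
theorem norm_aeval_padePoly_neg {u : E} {k : ℕ} (hu : ∀ j < k, B ((L ^ j) u) = 0) (τ : ℝ) :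
    ‖Polynomial.aeval ((τ : ℂ) • L) (padePoly k (-1)) u‖ =
      ‖Polynomial.aeval ((τ : ℂ) • L) (padePoly k 1) u‖ := by
  have key : inner ℂ (Polynomial.aeval ((τ : ℂ) • L) (padePoly k (-1)) u)
      (Polynomial.aeval ((τ : ℂ) • L) (padePoly k (-1)) u) =
      inner ℂ (Polynomial.aeval ((τ : ℂ) • L) (padePoly k 1) u)
      (Polynomial.aeval ((τ : ℂ) • L) (padePoly k 1) u) := by
    simp only [aeval_padePoly_apply, sum_inner, inner_sum, inner_smul_left, inner_smul_right,
      Complex.conj_ofReal, Finset.mul_sum]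
    rw [Finset.sum_comm]
    refine Finset.sum_congr rfl fun i hi => Finset.sum_congr rfl fun j hj => ?_
    rw [Finset.mem_range] at hi hj
    rw [inner_pow_apply_pow_apply hB hu (by omega : j ≤ k),
      inner_pow_apply_pow_apply hB hu (by omega : i ≤ k), add_comm j i]
    have hs : ((-1 : ℂ) ^ i) * (-1) ^ i = 1 := by rw [← mul_pow]; simp
    push_cast
    linear_combination ((-1) ^ j * padeCoeff k i * τ ^ i * (padeCoeff k j * τ ^ j) *
      inner ℂ u ((L ^ (i + j)) u)) * hs
  rw [inner_self_eq_norm_sq_to_K, inner_self_eq_norm_sq_to_K] at key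
  have key' : ‖Polynomial.aeval ((τ : ℂ) • L) (padePoly k (-1)) u‖ ^ 2 =
      ‖Polynomial.aeval ((τ : ℂ) • L) (padePoly k 1) u‖ ^ 2 := by exact_mod_cast key
  exact (pow_left_inj₀ (norm_nonneg _) (norm_nonneg _) two_ne_zero).1 key'

/-- The datum `D(τL)u` and the main part `D(-τL)u` of its image have equal norms, so the cross term
of order `τ^(p+1)` decides; its limiting coefficient is positive by `hpos`. -/
theorem eventually_norm_lt_of_pade_error {R Q : Polynomial ℂ} {p k : ℕ} {κ : ℝ} {u : E}
    (hR : R * padePoly k 1 = padePoly k (-1) +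
      Polynomial.X ^ (p + 1) * (Polynomial.C (κ : ℂ) + Polynomial.X * Q))
    (hu : ∀ j < k, B ((L ^ j) u) = 0)
    (hpos : 0 < κ * (inner ℂ u ((L ^ (p + 1)) u)).re) :
    ∀ᶠ τ : ℝ in 𝓝[>] 0, ‖Polynomial.aeval ((τ : ℂ) • L) (padePoly k 1) u‖ <
      ‖Polynomial.aeval ((τ : ℂ) • L) R (Polynomial.aeval ((τ : ℂ) • L) (padePoly k 1) u)‖ := by
  set v : ℝ → E := fun τ => Polynomial.aeval ((τ : ℂ) • L) (padePoly k (-1)) u with hv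
  set w : ℝ → E := fun τ => (L ^ (p + 1)) (Polynomial.aeval ((τ : ℂ) • L)
    (Polynomial.C (κ : ℂ) + Polynomial.X * Q) u) with hw
  have hvc : Continuous v := continuous_aeval_smul_apply _ _ _
  have hwc : Continuous w := by
    have : w = fun τ : ℝ => Polynomial.aeval ((τ : ℂ) • L)
        (Polynomial.C (κ : ℂ) + Polynomial.X * Q) ((L ^ (p + 1)) u) := by
      funext τ
      rw [hw]
      simp only [aeval_smul_apply, map_sum, map_smul]
      refine Finset.sum_congr rfl fun j _ => ?_
      rw [← Module.End.mul_apply, ← Module.End.mul_apply, ← pow_add, ← pow_add, add_comm (p + 1) j]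
    rw [this]
    exact continuous_aeval_smul_apply _ _ _
  have hv0 : v 0 = u := by
    rw [hv]
    simp only [aeval_padePoly_apply]
    rw [Finset.sum_eq_single 0]
    · simp [padeCoeff_zero]
    · intro j _ hj; simp [hj]
    · simp
  have hw0 : w 0 = (κ : ℂ) • (L ^ (p + 1)) u := by
    rw [hw]
    simp [Module.algebraMap_end_apply]
  have h0 : 0 < (inner ℂ (v 0) (w 0)).re := by
    rw [hv0, hw0, inner_smul_right, Complex.re_ofReal_mul]
    exact hpos
  have hc : Continuous fun τ => (inner ℂ (v τ) (w τ)).re :=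
    Complex.continuous_re.comp (hvc.inner hwc)
  have hev : ∀ᶠ τ : ℝ in 𝓝[>] 0, 0 < (inner ℂ (v τ) (w τ)).re :=
    ((hc.tendsto 0).eventually (lt_mem_nhds h0)).filter_mono nhdsWithin_le_nhds
  filter_upwards [hev, self_mem_nhdsWithin] with τ hτ hτ0
  have hτ0' : (0 : ℝ) < τ := hτ0
  have hdec : Polynomial.aeval ((τ : ℂ) • L) R (Polynomial.aeval ((τ : ℂ) • L) (padePoly k 1) u)
      = v τ + ((τ ^ (p + 1) : ℝ) : ℂ) • w τ := by
    rw [← Module.End.mul_apply, ← map_mul, hR, map_add, LinearMap.add_apply,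
      aeval_X_pow_mul_apply]
    push_cast
    rfl
  rw [hdec, ← norm_aeval_padePoly_neg hB hu τ]
  refine lt_of_pow_lt_pow_left₀ 2 (norm_nonneg _) ?_
  rw [norm_add_sq (𝕜 := ℂ), inner_smul_right]
  have h1 : 0 < τ ^ (p + 1) * (inner ℂ (v τ) (w τ)).re := by positivity
  have h2 : RCLike.re (((τ ^ (p + 1) : ℝ) : ℂ) * inner ℂ (v τ) (w τ)) =
      τ ^ (p + 1) * (inner ℂ (v τ) (w τ)).re := Complex.re_ofReal_mul _ _
  rw [h2]
  change ‖v τ‖ ^ 2 < _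
  nlinarith [sq_nonneg ‖((τ ^ (p + 1) : ℝ) : ℂ) • w τ‖]

theorem re_inner_pow_two_mul {u : E} {k : ℕ} (hu : ∀ j < k, B ((L ^ j) u) = 0) :
    (inner ℂ u ((L ^ (2 * k)) u)).re = (-1) ^ k * ‖(L ^ k) u‖ ^ 2 := by
  have h := inner_pow_apply_pow_apply hB hu le_rfl k
  rw [inner_self_eq_norm_sq_to_K] at h
  have hs : ((-1 : ℂ) ^ k) * (-1) ^ k = 1 := by rw [← mul_pow]; simp
  have h2 : inner ℂ u ((L ^ (2 * k)) u) = (((-1) ^ k * ‖(L ^ k) u‖ ^ 2 : ℝ) : ℂ) := by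
    rw [two_mul]
    push_cast
    have h' : ((‖(L ^ k) u‖ : ℂ)) ^ 2 = (-1) ^ k * inner ℂ u ((L ^ (k + k)) u) := h
    rw [h']
    linear_combination (-inner ℂ u ((L ^ (k + k)) u)) * hs
  rw [h2, Complex.ofReal_re]

/-- After `k` factors have crossed, one `L` is left between two copies of `L^k u`, and its real part
is the dissipation. -/
theorem re_inner_pow_two_mul_add_one {u : E} {k : ℕ} (hu : ∀ j < k, B ((L ^ j) u) = 0) :
    (inner ℂ u ((L ^ (2 * k + 1)) u)).re = -((-1) ^ k * ‖B ((L ^ k) u)‖ ^ 2) := by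
  have h := inner_pow_apply_pow_apply hB hu le_rfl (k + 1)
  have hs : ((-1 : ℂ) ^ k) * (-1) ^ k = 1 := by rw [← mul_pow]; simp
  have h2 : inner ℂ u ((L ^ (2 * k + 1)) u) =
      (((-1) ^ k : ℝ) : ℂ) * inner ℂ ((L ^ k) u) (L ((L ^ k) u)) := by
    rw [← Module.End.mul_apply, ← pow_succ', h, two_mul, add_assoc]
    push_cast
    linear_combination (-inner ℂ u ((L ^ (k + (k + 1))) u)) * hs
  rw [h2, Complex.re_ofReal_mul, re_inner_apply_self hB]
  ring

end Krylov

/-! ### Coercivity and contraction for small time steps. -/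

/-- A continuous, positive function that is homogeneous of degree two is coercive. -/
theorem exists_pos_mul_norm_sq_le {F : Type*} [NormedAddCommGroup F] [NormedSpace ℝ F]
    [ProperSpace F] {f : F → ℝ} (hf : Continuous f) (hh : ∀ (r : ℝ) x, f (r • x) = r ^ 2 * f x)
    (hpos : ∀ x, x ≠ 0 → 0 < f x) : ∃ c : ℝ, 0 < c ∧ ∀ x, c * ‖x‖ ^ 2 ≤ f x := by
  have h0 : f 0 = 0 := by simpa using hh 0 0
  rcases (Metric.sphere (0 : F) 1).eq_empty_or_nonempty with he | hne
  · refine ⟨1, one_pos, fun x => ?_⟩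
    obtain rfl : x = 0 := by
      by_contra hx
      have : ‖x‖⁻¹ • x ∈ Metric.sphere (0 : F) 1 := by
        simp [norm_smul, hx]
      rw [he] at this
      exact this
    simp [h0]
  · obtain ⟨y, hy, hmin⟩ := (isCompact_sphere (0 : F) 1).exists_isMinOn hne hf.continuousOn
    have hy0 : y ≠ 0 := by rintro rfl; simp at hy
    refine ⟨f y, hpos y hy0, fun x => ?_⟩
    rcases eq_or_ne x 0 with rfl | hx
    · simp [h0]
    · have hx' : ‖x‖ ≠ 0 := norm_ne_zero_iff.2 hx
      have h1 : f y ≤ f (‖x‖⁻¹ • x) := hmin (by simp [norm_smul, hx])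
      rw [hh] at h1
      have h2 := mul_le_mul_of_nonneg_right h1 (sq_nonneg ‖x‖)
      have h3 : (‖x‖⁻¹) ^ 2 * f x * ‖x‖ ^ 2 = f x := by field_simp
      linarith

/-- If the integral vanished, each coordinate would be a polynomial with infinitely many roots.
Rescaling time to `[0,1]` makes the constant independent of `τ`. -/
theorem exists_mul_norm_sq_le_integral_polynomial (n m : ℕ) :
    ∃ c : ℝ, 0 < c ∧ ∀ x : Fin (m + 1) → EuclideanSpace ℂ (Fin n),
      c * ‖x‖ ^ 2 ≤ ∫ s in (0 : ℝ)..1, ‖∑ j, ((s : ℂ) ^ j.val) • x j‖ ^ 2 := by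
  refine exists_pos_mul_norm_sq_le ?_ ?_ ?_
  · refine intervalIntegral.continuous_parametric_intervalIntegral_of_continuous' ?_ 0 1
    fun_prop
  · intro r x
    rw [← intervalIntegral.integral_const_mul]
    congr 1
    funext s
    have : ∑ j, ((s : ℂ) ^ j.val) • (r • x) j = r • ∑ j, ((s : ℂ) ^ j.val) • x j := by
      rw [Finset.smul_sum]
      refine Finset.sum_congr rfl fun j _ => ?_
      rw [Pi.smul_apply, smul_comm]
    rw [this, norm_smul, mul_pow, Real.norm_eq_abs, sq_abs]
  · intro x hx
    refine intervalIntegral.integral_pos zero_lt_one (by fun_prop) (fun s _ => by positivity) ?_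
    by_contra! hall
    refine hx (funext fun j => ?_)
    ext i
    have hP : (∑ j : Fin (m + 1), Polynomial.C (x j i) * Polynomial.X ^ j.val) = 0 := by
      refine Polynomial.eq_zero_of_infinite_isRoot _ (Set.Infinite.mono ?_
        ((Set.Icc_infinite (zero_lt_one' ℝ)).image (f := fun s : ℝ => (s : ℂ))
          Complex.ofReal_injective.injOn))
      rintro _ ⟨s, hs, rfl⟩
      have h1 := hall s hs
      have h2 : ∑ j, ((s : ℂ) ^ j.val) • x j = 0 :=
        norm_eq_zero.1 (pow_eq_zero_iff two_ne_zero |>.1 (le_antisymm h1 (by positivity)))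
      have h3 := congrArg (EuclideanSpace.proj i : EuclideanSpace ℂ (Fin n) →L[ℂ] ℂ) h2
      rw [map_sum, map_zero] at h3
      change Polynomial.eval _ _ = 0
      rw [Polynomial.eval_finsetSum, ← h3]
      refine Finset.sum_congr rfl fun j _ => ?_
      rw [Polynomial.eval_mul, Polynomial.eval_C, Polynomial.eval_pow, Polynomial.eval_X, map_smul,
        smul_eq_mul, mul_comm]
      rfl
    have h4 := congrArg (fun P => Polynomial.coeff P j.val) hP
    simpa [Polynomial.finsetSum_coeff, Polynomial.coeff_X_pow, Fin.val_inj] using h4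

section Dissipation

variable {n : ℕ}

local notation "𝔼" => EuclideanSpace ℂ (Fin n)

theorem exists_norm_apply_le (T : Module.End ℂ 𝔼) : ∃ C : ℝ, 0 ≤ C ∧ ∀ x, ‖T x‖ ≤ C * ‖x‖ :=
  ⟨‖LinearMap.toContinuousLinearMap T‖, norm_nonneg _,
    fun x => (LinearMap.toContinuousLinearMap T).le_opNorm x⟩

theorem exists_norm_aeval_le (L : Module.End ℂ 𝔼) (q : Polynomial ℂ) :
    ∃ C : ℝ, 0 ≤ C ∧ ∀ t : ℝ, 0 ≤ t → t ≤ 1 → ∀ u,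
      ‖Polynomial.aeval ((t : ℂ) • L) q u‖ ≤ C * ‖u‖ := by
  choose K hK0 hK using fun j : ℕ => exists_norm_apply_le (L ^ j)
  refine ⟨∑ j ∈ Finset.range (q.natDegree + 1), ‖q.coeff j‖ * K j,
    Finset.sum_nonneg fun j _ => mul_nonneg (norm_nonneg _) (hK0 j), fun t h0 h1 u => ?_⟩
  rw [aeval_smul_apply, Finset.sum_mul]
  refine (norm_sum_le _ _).trans (Finset.sum_le_sum fun j _ => ?_)
  rw [norm_smul, norm_mul, norm_pow, Complex.norm_real, Real.norm_of_nonneg h0, mul_assoc ‖_‖ (K j)]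
  refine mul_le_mul ?_ (hK j u) (norm_nonneg _) (norm_nonneg _)
  exact mul_le_of_le_one_right (norm_nonneg _) (pow_le_one₀ h0 h1)

theorem hasDerivAt_aeval_smul_apply (L : Module.End ℂ 𝔼) (q : Polynomial ℂ) (u : 𝔼) (t : ℝ) :
    HasDerivAt (fun t : ℝ => Polynomial.aeval ((t : ℂ) • L) q u)
      (L (Polynomial.aeval ((t : ℂ) • L) (Polynomial.derivative q) u)) t := by
  induction q using Polynomial.induction_on' with
  | add q r hq hr =>
    have e : (fun t : ℝ => Polynomial.aeval ((t : ℂ) • L) (q + r) u) =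
        (fun t : ℝ => Polynomial.aeval ((t : ℂ) • L) q u) +
          fun t : ℝ => Polynomial.aeval ((t : ℂ) • L) r u := by
      funext t; simp
    rw [e, Polynomial.derivative_add, map_add, LinearMap.add_apply, map_add]
    exact hq.add hr
  | monomial j a =>
    have h1 : HasDerivAt (fun t : ℝ => a * (t : ℂ) ^ j) (a * (j * (t : ℂ) ^ (j - 1))) t :=
      ((hasDerivAt_pow j (t : ℂ)).const_mul a).comp_ofReal
    have h2 := h1.smul_const ((L ^ j) u)
    have e : (fun t : ℝ => Polynomial.aeval ((t : ℂ) • L) (Polynomial.monomial j a) u) =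
        fun t : ℝ => (a * (t : ℂ) ^ j) • (L ^ j) u := by
      funext s
      rw [Polynomial.aeval_monomial, smul_pow, Module.End.mul_apply, LinearMap.smul_apply,
        Module.algebraMap_end_apply, smul_smul]
    have e' : L (Polynomial.aeval ((t : ℂ) • L) (Polynomial.derivative (Polynomial.monomial j a)) u)
        = (a * (j * (t : ℂ) ^ (j - 1))) • (L ^ j) u := by
      rw [Polynomial.derivative_monomial, Polynomial.aeval_monomial]
      rcases j with _ | j
      · simp
      · simp only [smul_pow, Module.End.mul_apply, LinearMap.smul_apply,
          Module.algebraMap_end_apply, map_smul, smul_smul, Nat.add_sub_cancel]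
        rw [← Module.End.mul_apply, ← pow_succ']
        congr 1
        ring
    rw [e, e']
    exact h2

/-- Polynomials whose first coefficients are those of `exp` contract for small times, provided
the dissipation is seen by the first `m` powers of `L`. -/
theorem exists_norm_aeval_le_norm {L B : Module.End ℂ 𝔼}
    (hB : ∀ x y, inner ℂ (L x) y + inner ℂ x (L y) = -2 * inner ℂ (B x) (B y))
    {m p : ℕ} (hinj : ∀ u, (∀ j ≤ m, B ((L ^ j) u) = 0) → u = 0) (hmp : 2 * m + 1 ≤ p)
    {R : Polynomial ℂ} (hR : ∀ j ≤ p, R.coeff j = (j.factorial : ℂ)⁻¹) :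
    ∃ τ₀ : ℝ, 0 < τ₀ ∧ ∀ τ : ℝ, 0 < τ → τ ≤ τ₀ →
      ∀ u, ‖Polynomial.aeval ((τ : ℂ) • L) R u‖ ≤ ‖u‖ := by
  set T : Polynomial ℂ :=
    ∑ i ∈ Finset.range (m + 1), Polynomial.C ((i.factorial : ℂ)⁻¹) * Polynomial.X ^ i with hT
  obtain ⟨Q₂, hQ₂⟩ : Polynomial.X ^ (m + 1) ∣ R - T := by
    rw [Polynomial.X_pow_dvd_iff]
    intro d hd
    rw [Polynomial.coeff_sub, hR d (by omega), hT, Polynomial.finsetSum_coeff]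
    simp [Polynomial.coeff_X_pow, hd]
  obtain ⟨Q₁, hQ₁⟩ : Polynomial.X ^ p ∣ Polynomial.derivative R - R := by
    rw [Polynomial.X_pow_dvd_iff]
    intro d hd
    have h0 : (d.factorial : ℂ) ≠ 0 := by exact_mod_cast (Nat.factorial_pos _).ne'
    have h1 : (d : ℂ) + 1 ≠ 0 := by exact_mod_cast Nat.succ_ne_zero d
    rw [Polynomial.coeff_sub, Polynomial.coeff_derivative, hR d (by omega), hR (d + 1) (by omega),
      Nat.factorial_succ]
    push_cast
    field_simp
    ring
  obtain ⟨CR, hCR0, hCR⟩ := exists_norm_aeval_le L R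
  obtain ⟨C₁, hC₁0, hC₁⟩ := exists_norm_aeval_le L Q₁
  obtain ⟨C₂, hC₂0, hC₂⟩ := exists_norm_aeval_le L Q₂
  obtain ⟨K₁, hK₁0, hK₁⟩ := exists_norm_apply_le (L ^ (p + 1))
  obtain ⟨K₂, hK₂0, hK₂⟩ := exists_norm_apply_le (B * L ^ (m + 1))
  obtain ⟨c₁, hc₁0, hc₁⟩ := exists_mul_norm_sq_le_integral_polynomial n m
  obtain ⟨c₂, hc₂0, hc₂⟩ : ∃ c : ℝ, 0 < c ∧ ∀ u : 𝔼,
      c * ‖u‖ ^ 2 ≤ ‖fun j : Fin (m + 1) => B ((L ^ j.val) u)‖ ^ 2 := by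
    refine exists_pos_mul_norm_sq_le ?_ ?_ ?_
    · have : Continuous fun u : 𝔼 => fun j : Fin (m + 1) => B ((L ^ j.val) u) :=
        continuous_pi fun j => (B * L ^ j.val).continuous_of_finiteDimensional
      exact this.norm.pow 2
    · intro r x
      have : (fun j : Fin (m + 1) => B ((L ^ j.val) (r • x))) =
          r • fun j : Fin (m + 1) => B ((L ^ j.val) x) := by
        funext j
        rw [Pi.smul_apply, LinearMap.map_smul_of_tower, LinearMap.map_smul_of_tower]
      rw [this, norm_smul, mul_pow, Real.norm_eq_abs, sq_abs]
    · intro x hx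
      have : (fun j : Fin (m + 1) => B ((L ^ j.val) x)) ≠ 0 := by
        intro h
        exact hx (hinj x fun j hj => congrFun h ⟨j, by omega⟩)
      have := norm_pos_iff.2 this
      positivity
  set K : ℝ := 2 * (K₂ * C₂) ^ 2 + 2 * CR * (K₁ * C₁) with hK
  have hK0 : 0 ≤ K := by positivity
  set γ : ℝ := c₁ * c₂ / (m.factorial : ℝ) ^ 2 with hγ
  have hγ0 : 0 < γ := by positivity
  -- `γ` measures the dissipation gained and `K` the errors; `K + 1` avoids dividing by a possibly
  -- vanishing `K`.
  refine ⟨min 1 (γ / (K + 1)), by positivity, fun τ hτ0 hτ u => ?_⟩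
  have hτ1 : τ ≤ 1 := hτ.trans (min_le_left _ _)
  have hτ2 : τ * (K + 1) ≤ γ := (le_div_iff₀ (by positivity)).1 (hτ.trans (min_le_right _ _))
  set w : ℝ → 𝔼 := fun t => Polynomial.aeval ((t : ℂ) • L) R u with hw
  set f : ℝ → 𝔼 := fun t => Polynomial.aeval ((t : ℂ) • L) T u with hf
  have hwc : Continuous w := continuous_aeval_smul_apply _ _ _
  have hfc : Continuous f := continuous_aeval_smul_apply _ _ _
  set w' : ℝ → 𝔼 :=
    fun t => L (Polynomial.aeval ((t : ℂ) • L) (Polynomial.derivative R) u) with hw'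
  have hBc : Continuous B := B.continuous_of_finiteDimensional
  have hLc : Continuous L := L.continuous_of_finiteDimensional
  have hwc' : Continuous w' := hLc.comp (continuous_aeval_smul_apply _ _ _)
  have hderiv : ∀ t : ℝ, HasDerivAt (fun t => ‖w t‖ ^ 2) (2 * (inner ℂ (w t) (w' t)).re) t := by
    intro t
    have hd := hasDerivAt_aeval_smul_apply L R u t
    have h1 := (Complex.reCLM.hasFDerivAt.comp_hasDerivAt t (hd.inner ℂ hd))
    have e : (fun t => ‖w t‖ ^ 2) = Complex.reCLM ∘ fun t => inner ℂ (w t) (w t) := by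
      funext s
      exact norm_sq_eq_re_inner (𝕜 := ℂ) (w s)
    have e' : 2 * (inner ℂ (w t) (w' t)).re =
        Complex.reCLM (inner ℂ (w t) (w' t) + inner ℂ (w' t) (w t)) := by
      rw [Complex.reCLM_apply, Complex.add_re, ← inner_conj_symm (w' t) (w t), Complex.conj_re]
      ring
    rw [e, e']
    exact h1
  have hbound : ∀ t ∈ Set.Icc 0 τ, 2 * (inner ℂ (w t) (w' t)).re ≤
      -‖B (f t)‖ ^ 2 + K * τ ^ (2 * m + 1) * ‖u‖ ^ 2 := by
    rintro t ⟨ht0, htτ⟩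
    have ht1 : t ≤ 1 := htτ.trans hτ1
    have e1 : w' t = L (w t) +
        ((t ^ p : ℝ) : ℂ) • (L ^ (p + 1)) (Polynomial.aeval ((t : ℂ) • L) Q₁ u) := by
      have : Polynomial.derivative R = R + Polynomial.X ^ p * Q₁ := by rw [← hQ₁]; ring
      rw [hw']
      simp only [this, map_add, LinearMap.add_apply, aeval_X_pow_mul_apply, map_smul]
      rw [pow_succ', Module.End.mul_apply]
      push_cast
      rfl
    have e2 : B (w t) = B (f t) +
        ((t ^ (m + 1) : ℝ) : ℂ) • (B * L ^ (m + 1)) (Polynomial.aeval ((t : ℂ) • L) Q₂ u) := by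
      have : R = T + Polynomial.X ^ (m + 1) * Q₂ := by rw [← hQ₂]; ring
      rw [hw, hf]
      simp only [Module.End.mul_apply]
      conv_lhs => rw [this]
      simp only [map_add, LinearMap.add_apply, aeval_X_pow_mul_apply, map_smul]
      push_cast
      rfl
    have e3 : (inner ℂ (w t) (w' t)).re = -‖B (w t)‖ ^ 2 + t ^ p *
        (inner ℂ (w t) ((L ^ (p + 1)) (Polynomial.aeval ((t : ℂ) • L) Q₁ u))).re := by
      rw [e1, inner_add_right, inner_smul_right, Complex.add_re, Complex.re_ofReal_mul,
        re_inner_apply_self hB]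
    have e4 : (inner ℂ (w t) ((L ^ (p + 1)) (Polynomial.aeval ((t : ℂ) • L) Q₁ u))).re ≤
        CR * (K₁ * C₁) * ‖u‖ ^ 2 := by
      refine (Complex.re_le_norm _).trans ((norm_inner_le_norm _ _).trans ?_)
      calc _ ≤ (CR * ‖u‖) * (K₁ * (C₁ * ‖u‖)) := by
            refine mul_le_mul (hCR t ht0 ht1 u) ((hK₁ _).trans ?_) (norm_nonneg _) (by positivity)
            exact mul_le_mul_of_nonneg_left (hC₁ t ht0 ht1 u) hK₁0
        _ = _ := by ring
    -- Half of the dissipation is given up to replace `w` by its Taylor part `f` of degree `m`.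
    have e5 : ‖B (f t)‖ ^ 2 ≤ 2 * ‖B (w t)‖ ^ 2 + 2 * (t ^ (m + 1) * (K₂ * C₂ * ‖u‖)) ^ 2 := by
      have h1 : ‖B (f t)‖ ≤ ‖B (w t)‖ + t ^ (m + 1) * (K₂ * C₂ * ‖u‖) := by
        have : B (f t) = B (w t) - ((t ^ (m + 1) : ℝ) : ℂ) •
          (B * L ^ (m + 1)) (Polynomial.aeval ((t : ℂ) • L) Q₂ u) := by rw [e2]; abel
        rw [this]
        refine (norm_sub_le _ _).trans (add_le_add le_rfl ?_)
        rw [norm_smul, Complex.norm_real, Real.norm_of_nonneg (by positivity), mul_assoc K₂]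
        refine mul_le_mul_of_nonneg_left ((hK₂ _).trans ?_) (by positivity)
        exact mul_le_mul_of_nonneg_left (hC₂ t ht0 ht1 u) hK₂0
      have h2 := pow_le_pow_left₀ (norm_nonneg _) h1 2
      nlinarith [sq_nonneg (‖B (w t)‖ - t ^ (m + 1) * (K₂ * C₂ * ‖u‖))]
    have e6 : t ^ p ≤ τ ^ (2 * m + 1) :=
      (pow_le_pow_of_le_one ht0 ht1 hmp).trans (pow_le_pow_left₀ ht0 htτ _)
    have e7 : (t ^ (m + 1)) ^ 2 ≤ τ ^ (2 * m + 1) := by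
      rw [← pow_mul]
      exact (pow_le_pow_of_le_one ht0 ht1 (by omega)).trans (pow_le_pow_left₀ ht0 htτ _)
    have e8 : t ^ p * (inner ℂ (w t) ((L ^ (p + 1)) (Polynomial.aeval ((t : ℂ) • L) Q₁ u))).re ≤
        τ ^ (2 * m + 1) * (CR * (K₁ * C₁) * ‖u‖ ^ 2) :=
      (mul_le_mul_of_nonneg_left e4 (by positivity)).trans
        (mul_le_mul_of_nonneg_right e6 (by positivity))
    have e9 : (t ^ (m + 1) * (K₂ * C₂ * ‖u‖)) ^ 2 ≤ τ ^ (2 * m + 1) * (K₂ * C₂ * ‖u‖) ^ 2 := by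
      rw [mul_pow]
      exact mul_le_mul_of_nonneg_right e7 (by positivity)
    rw [e3, hK]
    linarith
  have hint : ‖w τ‖ ^ 2 - ‖w 0‖ ^ 2 ≤
      -(∫ t in (0 : ℝ)..τ, ‖B (f t)‖ ^ 2) + τ * (K * τ ^ (2 * m + 1) * ‖u‖ ^ 2) := by
    have hdc : Continuous fun t => 2 * (inner ℂ (w t) (w' t)).re :=
      (Complex.continuous_re.comp (hwc.inner hwc')).const_mul 2 |>.congr fun _ => rfl
    rw [← intervalIntegral.integral_eq_sub_of_hasDerivAt (fun t _ => hderiv t)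
      (hdc.intervalIntegrable _ _)]
    have hB2 : Continuous fun t => ‖B (f t)‖ ^ 2 := (hBc.comp hfc).norm.pow 2
    refine (intervalIntegral.integral_mono_on hτ0.le (hdc.intervalIntegrable _ _)
      (Continuous.intervalIntegrable (by fun_prop) _ _) hbound).trans (le_of_eq ?_)
    have hB2' : Continuous fun t => -‖B (f t)‖ ^ 2 := hB2.neg
    rw [intervalIntegral.integral_add (hB2'.intervalIntegrable _ _)
      (continuous_const.intervalIntegrable _ _), intervalIntegral.integral_neg,
      intervalIntegral.integral_const, sub_zero, smul_eq_mul]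
  have hlower : τ * (γ * τ ^ (2 * m) * ‖u‖ ^ 2) ≤ ∫ t in (0 : ℝ)..τ, ‖B (f t)‖ ^ 2 := by
    have hsub := intervalIntegral.smul_integral_comp_mul_left (a := 0) (b := 1)
      (fun t => ‖B (f t)‖ ^ 2) τ
    rw [mul_zero, mul_one] at hsub
    rw [← hsub, smul_eq_mul]
    refine mul_le_mul_of_nonneg_left ?_ hτ0.le
    -- The coefficients of `s ↦ B (f (τ s))`. As `τ ≤ 1`, each weight `τ^j / j!` is at least `τ^m /
    -- m!`, whence the factor `τ^(2m)`.
    set x : Fin (m + 1) → 𝔼 :=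
      fun j => ((τ ^ j.val / (j.val.factorial : ℝ) : ℝ) : ℂ) • B ((L ^ j.val) u) with hx
    have hfx : ∀ s : ℝ, B (f (τ * s)) = ∑ j, ((s : ℂ) ^ j.val) • x j := by
      intro s
      rw [hf]
      simp only [hT, map_sum, LinearMap.sum_apply]
      rw [Finset.sum_range]
      refine Finset.sum_congr rfl fun j _ => ?_
      rw [map_mul, map_pow, Polynomial.aeval_X, Polynomial.aeval_C, Module.End.mul_apply,
        Module.algebraMap_end_apply, smul_pow, LinearMap.smul_apply, map_smul, map_smul, smul_smul,
        hx, smul_smul]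
      congr 1
      push_cast
      ring
    simp only [hfx]
    refine le_trans ?_ (hc₁ x)
    have hxn : ‖fun j : Fin (m + 1) => B ((L ^ j.val) u)‖ ≤ (m.factorial : ℝ) / τ ^ m * ‖x‖ := by
      refine (pi_norm_le_iff_of_nonneg (by positivity)).2 fun j => ?_
      have h1 := norm_le_pi_norm x j
      have hj : j.val ≤ m := by omega
      rw [hx] at h1
      simp only [norm_smul, Complex.norm_real] at h1
      rw [Real.norm_of_nonneg (by positivity)] at h1
      rw [div_mul_eq_mul_div, le_div_iff₀ (by positivity)]
      have h2 : τ ^ m ≤ τ ^ j.val := pow_le_pow_of_le_one hτ0.le hτ1 hj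
      have h3 : (j.val.factorial : ℝ) ≤ (m.factorial : ℝ) := by
        exact_mod_cast Nat.factorial_le hj
      have h4 : τ ^ m ≤ (m.factorial : ℝ) * (τ ^ j.val / (j.val.factorial : ℝ)) := by
        rw [mul_div_assoc', le_div_iff₀ (by positivity), mul_comm (m.factorial : ℝ)]
        exact mul_le_mul h2 h3 (by positivity) (by positivity)
      calc _ ≤ ‖B ((L ^ j.val) u)‖ * ((m.factorial : ℝ) * (τ ^ j.val / (j.val.factorial : ℝ))) :=
            mul_le_mul_of_nonneg_left h4 (norm_nonneg _)
        _ = (m.factorial : ℝ) * (τ ^ j.val / (j.val.factorial : ℝ) * ‖B ((L ^ j.val) u)‖) := by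
            ring
        _ ≤ _ := mul_le_mul_of_nonneg_left h1 (by positivity)
    have h5 := (hc₂ u).trans (pow_le_pow_left₀ (norm_nonneg _) hxn 2)
    have h6 : c₂ * ‖u‖ ^ 2 * (τ ^ (2 * m) / (m.factorial : ℝ) ^ 2) ≤ ‖x‖ ^ 2 := by
      refine (mul_le_mul_of_nonneg_right h5 (by positivity)).trans (le_of_eq ?_)
      have : (m.factorial : ℝ) ≠ 0 := by positivity
      have : τ ≠ 0 := hτ0.ne'
      rw [mul_comm 2 m, pow_mul]
      field_simp
    calc γ * τ ^ (2 * m) * ‖u‖ ^ 2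
        = c₁ * (c₂ * ‖u‖ ^ 2 * (τ ^ (2 * m) / (m.factorial : ℝ) ^ 2)) := by rw [hγ]; ring
      _ ≤ _ := mul_le_mul_of_nonneg_left h6 hc₁0.le
  have hw0 : w 0 = u := by
    have h1 : R.coeff 0 = 1 := by simpa using hR 0 (Nat.zero_le _)
    rw [hw]
    simp only [aeval_smul_apply, Complex.ofReal_zero]
    rw [Finset.sum_eq_single 0]
    · simp [h1]
    · intro j _ hj; simp [hj]
    · simp
  refine le_of_sq_le_sq ?_ (norm_nonneg _)
  have hfin : τ * (K * τ ^ (2 * m + 1) * ‖u‖ ^ 2) ≤ τ * (γ * τ ^ (2 * m) * ‖u‖ ^ 2) := by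
    have : 0 ≤ τ ^ (2 * m) * ‖u‖ ^ 2 * τ := by positivity
    have h2 : τ * K ≤ γ := by nlinarith
    calc _ = (τ ^ (2 * m) * ‖u‖ ^ 2 * τ) * (τ * K) := by ring
      _ ≤ (τ ^ (2 * m) * ‖u‖ ^ 2 * τ) * γ := mul_le_mul_of_nonneg_left h2 this
      _ = _ := by ring
  rw [hw0] at hint
  change ‖w τ‖ ^ 2 ≤ _
  linarith

end Dissipation

/-! ### The hypocoercivity index in terms of kernels. -/

section MatrixSide

variable {n : ℕ}

theorem inner_toEuclideanLin_conjTranspose (A : Matrix (Fin n) (Fin n) ℂ)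
    (x y : EuclideanSpace ℂ (Fin n)) :
    inner ℂ x (Matrix.toEuclideanLin Aᴴ y) = inner ℂ (Matrix.toEuclideanLin A x) y := by
  rw [Matrix.toEuclideanLin_conjTranspose_eq_adjoint, LinearMap.adjoint_inner_right]

theorem toEuclideanLin_mul_apply (A B : Matrix (Fin n) (Fin n) ℂ)
    (x : EuclideanSpace ℂ (Fin n)) :
    Matrix.toEuclideanLin (A * B) x = Matrix.toEuclideanLin A (Matrix.toEuclideanLin B x) := by
  rw [Matrix.toLpLin_mul_same]
  rfl

theorem inner_toEuclideanLin_eq_dotProduct (A : Matrix (Fin n) (Fin n) ℂ)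
    (x : EuclideanSpace ℂ (Fin n)) :
    inner ℂ x (Matrix.toEuclideanLin A x) = star x.ofLp ⬝ᵥ (A *ᵥ x.ofLp) := by
  rw [EuclideanSpace.inner_eq_star_dotProduct, dotProduct_comm]
  rfl

open scoped MatrixOrder in
theorem IsSemiDissipative.exists_eq_conjTranspose_mul_self {L : Matrix (Fin n) (Fin n) ℂ}
    (hL : IsSemiDissipative L) : ∃ B : Matrix (Fin n) (Fin n) ℂ, -hermPart L = Bᴴ * B :=
  CStarAlgebra.nonneg_iff_eq_star_mul_self.mp (Matrix.PosSemidef.nonneg hL)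

theorem skewPart_conjTranspose (L : Matrix (Fin n) (Fin n) ℂ) : (skewPart L)ᴴ = -skewPart L := by
  rw [skewPart, conjTranspose_smul, conjTranspose_sub, conjTranspose_conjTranspose, ← smul_neg,
    neg_sub]
  congr 1
  simp

theorem hermPart_add_skewPart (L : Matrix (Fin n) (Fin n) ℂ) : hermPart L + skewPart L = L := by
  rw [hermPart, skewPart, ← smul_add, add_add_sub_cancel, ← two_smul ℂ L, smul_smul]
  norm_num

theorem pow_apply_eq_of_forall_apply_eq_zero {E : Type*} [AddCommGroup E] [Module ℂ E]
    {f g b : Module.End ℂ E} (h : ∀ x, b x = 0 → f x = g x) {u : E} {k : ℕ}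
    (hu : ∀ j < k, b ((f ^ j) u) = 0) {j : ℕ} (hj : j ≤ k) : (f ^ j) u = (g ^ j) u := by
  induction j with
  | zero => simp
  | succ j ih =>
    rw [pow_succ', pow_succ', Module.End.mul_apply, Module.End.mul_apply, ← ih (by omega),
      h _ (hu j (by omega))]

section Factorization

variable {L B : Matrix (Fin n) (Fin n) ℂ} (hB : -hermPart L = Bᴴ * B)
include hB

theorem inner_add_inner_eq_of_hermPart (x y : EuclideanSpace ℂ (Fin n)) :
    inner ℂ (Matrix.toEuclideanLin L x) y + inner ℂ x (Matrix.toEuclideanLin L y) =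
      -2 * inner ℂ (Matrix.toEuclideanLin B x) (Matrix.toEuclideanLin B y) := by
  have h2 : Lᴴ + L = (-2 : ℂ) • (Bᴴ * B) := by
    rw [← hB, hermPart, smul_neg, smul_smul, ← neg_smul, add_comm]
    norm_num
  rw [← inner_toEuclideanLin_conjTranspose, ← inner_add_right, ← LinearMap.add_apply, ← map_add, h2,
    map_smul, LinearMap.smul_apply, inner_smul_right, toEuclideanLin_mul_apply,
    inner_toEuclideanLin_conjTranspose]

theorem toEuclideanLin_factor_apply_eq_zero_iff (x : EuclideanSpace ℂ (Fin n)) :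
    Matrix.toEuclideanLin B x = 0 ↔ Matrix.toEuclideanLin (hermPart L) x = 0 := by
  have h : Matrix.toEuclideanLin (hermPart L) x =
      -Matrix.toEuclideanLin Bᴴ (Matrix.toEuclideanLin B x) := by
    rw [← toEuclideanLin_mul_apply, ← hB, map_neg, LinearMap.neg_apply, neg_neg]
  constructor
  · intro h0
    rw [h, h0, map_zero, neg_zero]
  · intro h0
    rw [h, neg_eq_zero] at h0
    have h1 := inner_toEuclideanLin_conjTranspose B x (Matrix.toEuclideanLin B x)
    rw [h0, inner_zero_right] at h1
    exact inner_self_eq_zero.1 h1.symm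

theorem toEuclideanLin_eq_skewPart_of_factor_apply_eq_zero (x : EuclideanSpace ℂ (Fin n))
    (hx : Matrix.toEuclideanLin B x = 0) :
    Matrix.toEuclideanLin L x = Matrix.toEuclideanLin (skewPart L) x := by
  conv_lhs => rw [← hermPart_add_skewPart L]
  rw [map_add, LinearMap.add_apply, (toEuclideanLin_factor_apply_eq_zero_iff hB x).1 hx, zero_add]

/-- `L` and `L_S` agree on `ker B`, so their powers of `u` coincide as long as the earlier ones lie
in that kernel; `L_S* = -L_S` only changes signs. -/
theorem forall_factor_pow_skewPart_iff (u : EuclideanSpace ℂ (Fin n)) (m : ℕ) :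
    (∀ j ≤ m, Matrix.toEuclideanLin (B * (skewPart L)ᴴ ^ j) u = 0) ↔
      ∀ j ≤ m, Matrix.toEuclideanLin B
        (((Matrix.toEuclideanLin L : Module.End ℂ _) ^ j) u) = 0 := by
  have hsgn : ∀ j, Matrix.toEuclideanLin (B * (skewPart L)ᴴ ^ j) u = 0 ↔
      Matrix.toEuclideanLin B
        (((Matrix.toEuclideanLin (skewPart L) : Module.End ℂ _) ^ j) u) = 0 := by
    intro j
    rw [skewPart_conjTranspose, toEuclideanLin_mul_apply, neg_pow, toEuclideanLin_mul_apply,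
      Matrix.toLpLin_pow 2 (skewPart L)]
    rcases neg_one_pow_eq_or (Matrix (Fin n) (Fin n) ℂ) j with h | h <;> rw [h] <;> simp
  simp only [hsgn]
  have key := fun x hx => toEuclideanLin_eq_skewPart_of_factor_apply_eq_zero hB x hx
  constructor
  · intro h j hj
    rw [← pow_apply_eq_of_forall_apply_eq_zero (fun x hx => (key x hx).symm)
      (fun i (hi : i < m + 1) => h i (by omega)) (show j ≤ m + 1 by omega)]
    exact h j hj
  · intro h j hj
    rw [← pow_apply_eq_of_forall_apply_eq_zero key
      (fun i (hi : i < m + 1) => h i (by omega)) (show j ≤ m + 1 by omega)]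
    exact h j hj

theorem neg_hcMatrix_eq_sum (m : ℕ) :
    -hcMatrix L m = ∑ j ∈ Finset.range (m + 1),
      (B * (skewPart L)ᴴ ^ j)ᴴ * (B * (skewPart L)ᴴ ^ j) := by
  rw [hcMatrix, ← Finset.sum_neg_distrib]
  refine Finset.sum_congr rfl fun j _ => ?_
  rw [conjTranspose_mul, conjTranspose_pow, conjTranspose_conjTranspose, mul_assoc _ Bᴴ,
    ← mul_assoc Bᴴ, ← hB, neg_mul, mul_neg, mul_assoc]

/-- The quadratic form of `-T_m` is `∑ ‖B (L_S*)^j u‖²`, which vanishes exactly on the common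
kernel. -/
theorem posDef_neg_hcMatrix_iff (m : ℕ) :
    (-hcMatrix L m).PosDef ↔ ∀ u : EuclideanSpace ℂ (Fin n),
      (∀ j ≤ m, Matrix.toEuclideanLin B
        (((Matrix.toEuclideanLin L : Module.End ℂ _) ^ j) u) = 0) → u = 0 := by
  have hform : ∀ u : EuclideanSpace ℂ (Fin n), star u.ofLp ⬝ᵥ (-hcMatrix L m *ᵥ u.ofLp) =
      ((∑ j ∈ Finset.range (m + 1),
        ‖Matrix.toEuclideanLin (B * (skewPart L)ᴴ ^ j) u‖ ^ 2 : ℝ) : ℂ) := by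
    intro u
    rw [← inner_toEuclideanLin_eq_dotProduct, neg_hcMatrix_eq_sum hB, map_sum, LinearMap.sum_apply,
      inner_sum]
    push_cast
    refine Finset.sum_congr rfl fun j _ => ?_
    rw [toEuclideanLin_mul_apply, inner_toEuclideanLin_conjTranspose, inner_self_eq_norm_sq_to_K]
    rfl
  have hherm : (-hcMatrix L m).IsHermitian := by
    rw [neg_hcMatrix_eq_sum hB]
    exact isSelfAdjoint_sum _ fun j _ => isHermitian_conjTranspose_mul_self _
  constructor
  · intro hpd u hu
    by_contra hne
    have h1 := hpd.dotProduct_mulVec_pos (x := u.ofLp) (fun h => hne (by ext i; simp [h]))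
    rw [hform, Finset.sum_eq_zero] at h1
    · simp at h1
    · intro j hj
      rw [(forall_factor_pow_skewPart_iff hB u m).2 hu j (by simpa [Nat.lt_succ_iff] using hj)]
      simp
  · intro h
    refine .of_dotProduct_mulVec_pos hherm fun x hx => ?_
    have hf := hform (WithLp.toLp 2 x)
    rw [hf]
    have hnn : 0 ≤ ∑ j ∈ Finset.range (m + 1),
        ‖Matrix.toEuclideanLin (B * (skewPart L)ᴴ ^ j) (WithLp.toLp 2 x)‖ ^ 2 :=
      Finset.sum_nonneg fun _ _ => by positivity
    rcases hnn.eq_or_lt with h0 | h0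
    · refine absurd (h (WithLp.toLp 2 x) ?_) (by simpa using hx)
      rw [← forall_factor_pow_skewPart_iff hB]
      intro j hj
      have := (Finset.sum_eq_zero_iff_of_nonneg (fun _ _ => by positivity)).1 h0.symm j
        (Finset.mem_range.2 (by omega))
      exact norm_eq_zero.1 (pow_eq_zero_iff two_ne_zero |>.1 this)
    · exact_mod_cast h0

end Factorization

theorem IsAsymptoticallyStable.re_neg {L : Matrix (Fin n) (Fin n) ℂ}
    (hL : IsAsymptoticallyStable L) {μ : ℂ} {v : EuclideanSpace ℂ (Fin n)} (hv : v ≠ 0)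
    (h : Matrix.toEuclideanLin L v = μ • v) : μ.re < 0 := by
  refine hL μ (Module.End.hasEigenvalue_of_hasEigenvector (x := v.ofLp) ⟨?_, ?_⟩)
  · rw [Module.End.mem_eigenspace_iff]
    exact congrArg WithLp.ofLp h
  · intro h0
    exact hv (by ext i; simp [h0])

theorem IsAsymptoticallyStable.pow_apply_ne_zero {L : Matrix (Fin n) (Fin n) ℂ}
    (hL : IsAsymptoticallyStable L) {v : EuclideanSpace ℂ (Fin n)} (hv : v ≠ 0) (k : ℕ) :
    ((Matrix.toEuclideanLin L : Module.End ℂ _) ^ k) v ≠ 0 := by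
  induction k with
  | zero => simpa
  | succ k ih =>
    rw [pow_succ', Module.End.mul_apply]
    intro h
    have := hL.re_neg (μ := 0) ih (by simpa using h)
    simp at this

/-- For asymptotically stable systems the kernels of `B, BL, BL², …` strictly decrease to `0`. -/
theorem IsAsymptoticallyStable.exists_factor_pow_ne_zero {L B : Matrix (Fin n) (Fin n) ℂ}
    (hL : IsAsymptoticallyStable L) (hB : -hermPart L = Bᴴ * B) {k : ℕ} (hk : 1 ≤ k)
    {u : EuclideanSpace ℂ (Fin n)} (hu0 : u ≠ 0)
    (hu : ∀ j < k, Matrix.toEuclideanLin B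
      (((Matrix.toEuclideanLin L : Module.End ℂ _) ^ j) u) = 0) :
    ∃ v : EuclideanSpace ℂ (Fin n),
      (∀ j < k, Matrix.toEuclideanLin B
        (((Matrix.toEuclideanLin L : Module.End ℂ _) ^ j) v) = 0) ∧
      Matrix.toEuclideanLin B (((Matrix.toEuclideanLin L : Module.End ℂ _) ^ k) v) ≠ 0 := by
  by_contra! hall
  set Λ : Module.End ℂ (EuclideanSpace ℂ (Fin n)) := Matrix.toEuclideanLin L with hΛ
  set β : Module.End ℂ (EuclideanSpace ℂ (Fin n)) := Matrix.toEuclideanLin B with hβ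
  -- If the kernels stopped shrinking, `W` would be a nonzero `L`-invariant subspace of `ker B`. An
  -- eigenvector in it is undamped, so its eigenvalue has real part zero.
  let W : Submodule ℂ (EuclideanSpace ℂ (Fin n)) :=
    ⨅ j : Fin k, LinearMap.ker (β * Λ ^ j.val)
  have hW : ∀ x, x ∈ W ↔ ∀ j < k, β ((Λ ^ j) x) = 0 := by
    intro x
    simp only [W, Submodule.mem_iInf, LinearMap.mem_ker, Module.End.mul_apply]
    exact ⟨fun h j hj => h ⟨j, hj⟩, fun h j => h j.val j.isLt⟩
  have hinv : ∀ x ∈ W, Λ x ∈ W := by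
    intro x hx
    have hx' := (hW x).1 hx
    refine (hW _).2 fun j hj => ?_
    rw [← Module.End.mul_apply (Λ ^ j), ← pow_succ]
    rcases Nat.lt_or_ge (j + 1) k with h | h
    · exact hx' _ h
    · obtain rfl : j + 1 = k := by omega
      exact hall x hx'
  have : Nontrivial W := ⟨⟨⟨u, (hW u).2 hu⟩, 0, fun h => hu0 (congrArg Subtype.val h)⟩⟩
  obtain ⟨μ, hμ⟩ := Module.End.exists_eigenvalue (Λ.restrict hinv)
  obtain ⟨v, hv⟩ := hμ.exists_hasEigenvector
  have hv1 : Λ v.val = μ • v.val := congrArg Subtype.val hv.apply_eq_smul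
  have hv0 : v.val ≠ 0 := fun h => hv.2 (Subtype.ext h)
  have hneg := hL.re_neg hv0 hv1
  have hre := re_inner_apply_self (L := Λ) (B := β) (inner_add_inner_eq_of_hermPart hB) v.val
  have hβv : β v.val = 0 := by simpa using (hW _).1 v.2 0 (by omega)
  rw [hv1, hβv, inner_smul_right, inner_self_eq_norm_sq_to_K] at hre
  have h2 : (μ * ((‖v.val‖ : ℝ) : ℂ) ^ 2).re = μ.re * ‖v.val‖ ^ 2 := by
    rw [← Complex.ofReal_pow, Complex.re_mul_ofReal]
  have h3 : μ.re * ‖v.val‖ ^ 2 = 0 := by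
    rw [← h2]
    simpa using hre
  have h4 : 0 < ‖v.val‖ ^ 2 := by
    have := norm_pos_iff.2 hv0
    positivity
  nlinarith

end MatrixSide

/-! ### Stable matrices of large hypocoercivity index. -/

/-- A chain with nearest-neighbour skew coupling that is damped at its first site only. -/
noncomputable def dampedChain (k : ℕ) : Matrix (Fin (k + 1)) (Fin (k + 1)) ℂ := fun i j =>
  if i.val = 0 ∧ j.val = 0 then -1 else if j.val = i.val + 1 then 1
  else if i.val = j.val + 1 then -1 else 0

theorem hermPart_dampedChain (k : ℕ) :
    hermPart (dampedChain k) =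
      Matrix.diagonal fun i : Fin (k + 1) => if i.val = 0 then (-1 : ℂ) else 0 := by
  ext i j
  rw [hermPart, Matrix.smul_apply, Matrix.add_apply, Matrix.conjTranspose_apply,
    Matrix.diagonal_apply, dampedChain, dampedChain]
  simp only [Fin.ext_iff]
  split_ifs <;> first | omega | norm_num

theorem isSemiDissipative_dampedChain (k : ℕ) : IsSemiDissipative (dampedChain k) := by
  rw [IsSemiDissipative, hermPart_dampedChain, Matrix.diagonal_neg]
  refine Matrix.PosSemidef.diagonal fun i => ?_
  by_cases h : i.val = 0 <;> simp [h]

theorem toEuclideanLin_hermPart_dampedChain_eq_zero_iff (k : ℕ)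
    (x : EuclideanSpace ℂ (Fin (k + 1))) :
    Matrix.toEuclideanLin (hermPart (dampedChain k)) x = 0 ↔ x 0 = 0 := by
  have h : ∀ i, Matrix.toEuclideanLin (hermPart (dampedChain k)) x i =
      (if i.val = 0 then (-1 : ℂ) else 0) * x i := by
    intro i
    rw [hermPart_dampedChain]
    exact Matrix.mulVec_diagonal (fun i : Fin (k + 1) => if i.val = 0 then (-1 : ℂ) else 0) x.ofLp i
  constructor
  · intro h0
    have := h 0
    rw [h0] at this
    simpa using this.symm
  · intro h0
    ext i
    rw [h i]
    by_cases hi : i.val = 0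
    · obtain rfl : i = 0 := Fin.ext hi
      simp [h0]
    · simp [hi]

theorem dampedChain_apply (k : ℕ) (x : EuclideanSpace ℂ (Fin (k + 1))) (i : Fin (k + 1)) :
    Matrix.toEuclideanLin (dampedChain k) x i = ∑ j, dampedChain k i j * x j :=
  rfl

/-- An eigenvector whose eigenvalue has nonnegative real part is undamped, hence zero at the first
site; row `d` of the eigenvalue equation then passes the zero on to site `d + 1`. -/
theorem isAsymptoticallyStable_dampedChain (k : ℕ) : IsAsymptoticallyStable (dampedChain k) := by
  intro μ hμ
  obtain ⟨y, hy⟩ := hμ.exists_hasEigenvector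
  set v : EuclideanSpace ℂ (Fin (k + 1)) := WithLp.toLp 2 y with hv
  have hv0 : v ≠ 0 := by simpa [hv] using hy.2
  have hLv : Matrix.toEuclideanLin (dampedChain k) v = μ • v :=
    congrArg (WithLp.toLp 2) hy.apply_eq_smul
  obtain ⟨B, hB⟩ := (isSemiDissipative_dampedChain k).exists_eq_conjTranspose_mul_self
  have hre := re_inner_apply_self (inner_add_inner_eq_of_hermPart hB) v
  rw [hLv, inner_smul_right, inner_self_eq_norm_sq_to_K] at hre
  have hre' : μ.re * ‖v‖ ^ 2 = -‖Matrix.toEuclideanLin B v‖ ^ 2 := by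
    rw [← hre]
    change _ = (μ * ((‖v‖ : ℝ) : ℂ) ^ 2).re
    rw [← Complex.ofReal_pow, Complex.re_mul_ofReal]
  by_contra! hpos
  have hBv : Matrix.toEuclideanLin B v = 0 := by
    have h1 : 0 ≤ μ.re * ‖v‖ ^ 2 := by positivity
    have h2 : ‖Matrix.toEuclideanLin B v‖ ^ 2 = 0 := by
      have := sq_nonneg ‖Matrix.toEuclideanLin B v‖
      linarith
    exact norm_eq_zero.1 (pow_eq_zero_iff two_ne_zero |>.1 h2)
  have hz : v 0 = 0 := (toEuclideanLin_hermPart_dampedChain_eq_zero_iff k v).1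
    ((toEuclideanLin_factor_apply_eq_zero_iff hB v).1 hBv)
  refine hv0 ?_
  ext i
  change v i = 0
  induction hi : i.val using Nat.strong_induction_on generalizing i with
  | _ d ih =>
    rcases d with _ | d
    · obtain rfl : i = 0 := Fin.ext hi
      exact hz
    · have hlt : d < k + 1 := by omega
      have hrow := dampedChain_apply k v ⟨d, hlt⟩
      rw [Finset.sum_eq_single i] at hrow
      · rw [hLv] at hrow
        have h1 : (μ • v) ⟨d, hlt⟩ = 0 := by
          rw [PiLp.smul_apply, ih d (by omega) ⟨d, hlt⟩ rfl, smul_zero]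
        have h2 : dampedChain k ⟨d, hlt⟩ i = 1 := by simp [dampedChain, hi]
        rw [h1, h2, one_mul] at hrow
        exact hrow.symm
      · intro j _ hj
        have hj' : j.val ≠ d + 1 := fun h => hj (Fin.ext (h.trans hi.symm))
        rcases Nat.lt_or_ge j.val (d + 1) with h | h
        · rw [ih j.val h j rfl, mul_zero]
        · have : dampedChain k ⟨d, hlt⟩ j = 0 := by
            simp only [dampedChain]
            split_ifs <;> first | omega | rfl
          rw [this, zero_mul]
      · simp

/-- A vector at the last site spreads by one site per application of `L`, so fewer than `k`
applications do not reach the damped site. -/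
theorem le_hcIndex_dampedChain (k : ℕ) : (k : ℕ∞) ≤ hcIndex (dampedChain k) := by
  refine le_sInf ?_
  rintro _ ⟨m, rfl, hm⟩
  by_contra! hlt
  have hmk : m < k := by exact_mod_cast hlt
  obtain ⟨B, hB⟩ := (isSemiDissipative_dampedChain k).exists_eq_conjTranspose_mul_self
  set e : EuclideanSpace ℂ (Fin (k + 1)) := EuclideanSpace.single (Fin.last k) 1 with he
  have hsupp : ∀ j ≤ k, ∀ i : Fin (k + 1), i.val < k - j →
      (((Matrix.toEuclideanLin (dampedChain k) : Module.End ℂ _) ^ j) e) i = 0 := by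
    intro j
    induction j with
    | zero =>
      intro _ i hi
      have : i ≠ Fin.last k := by rintro rfl; simp at hi
      simp [he, this]
    | succ j ih =>
      intro hj i hi
      rw [pow_succ', Module.End.mul_apply, dampedChain_apply]
      refine Finset.sum_eq_zero fun l _ => ?_
      rcases Nat.lt_or_ge l.val (k - j) with h | h
      · rw [ih (by omega) l h, mul_zero]
      · have : dampedChain k i l = 0 := by
          simp only [dampedChain]
          split_ifs <;> first | omega | rfl
        rw [this, zero_mul]
  have h0 := (posDef_neg_hcMatrix_iff hB m).1 hm e fun j hj => by
    rw [toEuclideanLin_factor_apply_eq_zero_iff hB,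
      toEuclideanLin_hermPart_dampedChain_eq_zero_iff]
    exact hsupp j (by omega) 0 (by simp; omega)
  have h1 := congrArg (fun x : EuclideanSpace ℂ (Fin (k + 1)) => x (Fin.last k)) h0
  simp [he] at h1

theorem dampedChain_mem_LAS (k : ℕ) :
    (⟨k + 1, dampedChain k⟩ : Σ n : ℕ, Matrix (Fin n) (Fin n) ℂ) ∈ LAS :=
  ⟨isAsymptoticallyStable_dampedChain k, isSemiDissipative_dampedChain k⟩

/-! ### Assembly of the stability and instability statements. -/

theorem ExplicitRK.HasOrder.stronglyStableOn_LASle {M : ExplicitRK} {p : ℕ} (hM : M.HasOrder p)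
    {m : ℕ} (hm : 2 * m + 1 ≤ p) : M.StronglyStableOn (LASle m) := by
  rintro ⟨n, L⟩ ⟨⟨_, hsd⟩, hidx⟩
  obtain ⟨B, hB⟩ := hsd.exists_eq_conjTranspose_mul_self
  -- The infimum of the empty set is `⊤`, so a finite index is attained.
  have hne : {k : ℕ∞ | ∃ m : ℕ, k = (m : ℕ∞) ∧ (-hcMatrix L m).PosDef}.Nonempty := by
    by_contra hemp
    rw [Set.not_nonempty_iff_eq_empty] at hemp
    simp [hcIndex, hemp] at hidx
  obtain ⟨m', hm', hpd⟩ := csInf_mem hne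
  have hle : m' ≤ m := by
    have : (m' : ℕ∞) ≤ m := by rw [← hm']; exact hidx
    exact_mod_cast this
  obtain ⟨τ₀, hτ₀, h⟩ := exists_norm_aeval_le_norm (inner_add_inner_eq_of_hermPart hB)
    ((posDef_neg_hcMatrix_iff hB m').1 hpd) (show 2 * m' + 1 ≤ p by omega)
    (fun j hj => hM.coeff_stabilityFunction hj)
  refine ⟨τ₀, hτ₀, fun τ h0 h1 u => ?_⟩
  rw [M.matStep_eq_aeval]
  exact h τ h0 h1 u

theorem ExplicitRK.HasOrder.not_stronglyStableOn_singleton {M : ExplicitRK} {p : ℕ} (hp : 1 ≤ p)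
    (hM : M.HasOrder p) {c : ℝ} (hc : M.stabilityCoeff (p + 1) = (c : ℂ)) (hs : SignCondition p c)
    {L : Σ n : ℕ, Matrix (Fin n) (Fin n) ℂ} (hL : L ∈ LAS)
    (hidx : (p : ℕ∞) < 2 * hcIndex L.2 + 1) : ¬ M.StronglyStableOn {L} := by
  obtain ⟨n, L⟩ := L
  obtain ⟨has, hsd⟩ := hL
  change IsAsymptoticallyStable L at has
  change IsSemiDissipative L at hsd
  change (p : ℕ∞) < 2 * hcIndex L + 1 at hidx
  obtain ⟨B, hB⟩ := hsd.exists_eq_conjTranspose_mul_self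
  have hB' := inner_add_inner_eq_of_hermPart hB
  obtain ⟨κ, Q, hR, hodd, heven⟩ :=
    exists_pade_error (fun j hj => hM.coeff_stabilityFunction hj) hc hs
  set k := (p + 1) / 2 with hk
  -- Since `2(k-1)+1 ≤ p`, the index exceeds `k - 1`; this provides a nonzero `u` with `BL^j u = 0`
  -- for all `j < k`.
  have hnpd : ¬ (-hcMatrix L (k - 1)).PosDef := by
    intro hpd
    have h1 : hcIndex L ≤ ((k - 1 : ℕ) : ℕ∞) := sInf_le ⟨k - 1, rfl, hpd⟩
    have h2 : 2 * hcIndex L + 1 ≤ 2 * ((k - 1 : ℕ) : ℕ∞) + 1 := by gcongr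
    have h3 : 2 * ((k - 1 : ℕ) : ℕ∞) + 1 ≤ (p : ℕ∞) := by
      exact_mod_cast (show 2 * (k - 1) + 1 ≤ p by omega)
    exact absurd (hidx.trans_le (h2.trans h3)) (lt_irrefl _)
  rw [posDef_neg_hcMatrix_iff hB] at hnpd
  push Not at hnpd
  obtain ⟨u, hu, hu0⟩ := hnpd
  have hu' : ∀ j < k, Matrix.toEuclideanLin B
      (((Matrix.toEuclideanLin L : Module.End ℂ _) ^ j) u) = 0 := fun j hj => hu j (by omega)
  obtain ⟨v, hv, hpos⟩ : ∃ v : EuclideanSpace ℂ (Fin n),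
      (∀ j < k, Matrix.toEuclideanLin B
        (((Matrix.toEuclideanLin L : Module.End ℂ _) ^ j) v) = 0) ∧
      0 < κ * (inner ℂ v (((Matrix.toEuclideanLin L : Module.End ℂ _) ^ (p + 1)) v)).re := by
    -- For even `p` the sign comes from `‖BL^k v‖²`, so `v` must be chosen with `BL^k v ≠ 0`; for
    -- odd `p` it comes from `‖L^k u‖²`, nonzero because `L` is injective.
    rcases Nat.even_or_odd p with he | ho
    · obtain ⟨v, hv, hv0⟩ := has.exists_factor_pow_ne_zero hB (by omega) hu0 hu'
      refine ⟨v, hv, ?_⟩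
      have h2 : p + 1 = 2 * k + 1 := by obtain ⟨i, hi⟩ := he; omega
      rw [h2, re_inner_pow_two_mul_add_one hB' hv]
      have := norm_pos_iff.2 hv0
      have h3 := mul_neg_of_neg_of_pos (heven he) (pow_pos this 2)
      linarith
    · refine ⟨u, hu', ?_⟩
      have h2 : p + 1 = 2 * k := by obtain ⟨i, hi⟩ := ho; omega
      rw [h2, re_inner_pow_two_mul hB' hu']
      have := norm_pos_iff.2 (has.pow_apply_ne_zero hu0 k)
      have h3 := mul_pos (hodd ho) (pow_pos this 2)
      linarith
  intro hstab
  obtain ⟨τ₀, hτ₀, hst⟩ := hstab ⟨n, L⟩ rfl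
  obtain ⟨τ, hτ, hτ1, hτ2⟩ := ((eventually_norm_lt_of_pade_error hB' hR hv hpos).and
    (Ioc_mem_nhdsGT hτ₀)).exists
  have := hst τ hτ1 hτ2 (Polynomial.aeval
    ((τ : ℂ) • (Matrix.toEuclideanLin L : Module.End ℂ _)) (padePoly k 1) v)
  rw [M.matStep_eq_aeval] at this
  exact absurd hτ (not_lt.2 this)

theorem mainTheorem2 (M : ExplicitRK) (p : ℕ) (hp : 1 ≤ p) (hM : M.HasOrder p) :
    (∀ m : ℕ, 2 * m + 1 ≤ p → M.StronglyStableOn (LASle m)) ∧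
    (∀ c : ℝ, M.stabilityCoeff (p + 1) = (c : ℂ) → SignCondition p c →
      ¬ M.StronglyStableOn LAS ∧
      (∀ L ∈ LAS, (p : ℕ∞) < 2 * hcIndex L.2 + 1 → ¬ M.StronglyStableOn {L}) ∧
      (∀ m : ℕ, 2 * m + 1 ≤ p →
        M.StronglyStableOn (LASle m) ∧ ¬ M.StronglyStableOn (LAS \ LASle m))) := by
  refine ⟨fun m hm => hM.stronglyStableOn_LASle hm, fun c hc hs => ?_⟩
  have hsingle := fun L hL hidx => hM.not_stronglyStableOn_singleton hp hc hs (L := L) hL hidx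
  -- One chain serves all negative claims: its index is at least `p`, so `2p+1 > p`, and `p > m`
  -- whenever `2m+1 ≤ p`.
  have hex : ¬ M.StronglyStableOn {⟨p + 1, dampedChain p⟩} := by
    refine hsingle _ (dampedChain_mem_LAS p) ?_
    have h1 : 2 * (p : ℕ∞) + 1 ≤ 2 * hcIndex (dampedChain p) + 1 := by
      gcongr
      exact le_hcIndex_dampedChain p
    refine lt_of_lt_of_le ?_ h1
    exact_mod_cast (show p < 2 * p + 1 by omega)
  refine ⟨fun h => hex ?_, hsingle, fun m hm => ⟨hM.stronglyStableOn_LASle hm, fun h => hex ?_⟩⟩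
  · rintro _ rfl
    exact h _ (dampedChain_mem_LAS p)
  · rintro _ rfl
    refine h _ ⟨dampedChain_mem_LAS p, fun hle => ?_⟩
    have h1 : (p : ℕ∞) ≤ m := (le_hcIndex_dampedChain p).trans hle.2
    have h2 : p ≤ m := by exact_mod_cast h1
    omega
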